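/- **System.** Let $f\ge 0$ and $n=3f+1$. An asynchronous message-passing system consists of servers $s_1,\dots,s_n$, a writer $p_w$ (also the auditor) and arbitrarily many readers. At most $f$ servers and any set of readers are Byzantine (they may send arbitrary messages, but only in their own name); the writer can fail only by crashing. Point-to-point channels are authenticated: a message is received at most once and only if it was sent by its claimed sender. The writer also has a reliable broadcast: a correct server delivers each broadcast message at most once, and only messages that the writer broadcast. Delays are arbitrary. The writer and each correct reader invoke their operations sequentially. From a pair $(v,t)$ one generates blocks $b_1,\dots,b_n$, where only $s_i$ can decrypt $b_i$; any $2f+1$ different blocks are necessary and sufficient to reconstruct $(v,t)$. **Algorithm.** Server $s_i$ keeps $reg\_ts$ (initially $0$), a map $val$ from timestamps to its blocks (initially its block of the initial value $v_0$ under timestamp $0$) and a log (initially empty). *Write($v$).* The writer increments $ts$ (initially $0$), broadcasts $(ts,[b_1,\dots,b_n])$ with the encrypted blocks of $(v,ts)$, waits until $n-f$ servers have acknowledged $ts$, and returns. On delivery of $(t,[b_1,\dots,b_n])$, $s_i$ stores its decrypted block in $val[t]$, sets $reg\_ts\leftarrow\max(reg\_ts,t)$ and acknowledges $t$. *Read.*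 The reader increments its sequence number, empties its variables, and sends TS_REQ to all servers; all messages carry the sequence number and the reader ignores answers with another one. A server answers TS_REQ with TS_RESP($reg\_ts$). A timestamp received from $s_i$ in a TS_RESP or VAL_RESP is added to the set $C_i$. Let $notOld(t)$ mean that at least $2f+1$ indices $i$ satisfy $C_i\neq\emptyset$ and $\min C_i\le t$. Whenever a TS_RESP arrives and at least $n-f$ of the $C_i$ are then non-empty, the reader sets $min\_ts$ to the least $t\in\bigcup_i C_i$ with $notOld(t)$ and sends VAL_REQ($min\_ts$) to all servers. A server answers VAL_REQ($t$) with VAL_RESP($t$) once $reg\_ts\ge t$. When $min\_ts$ belongs to at least $f+1$ of the sets $C_i$, the reader sends (once per read) BLOCK_REQ with the signed record (reader, $min\_ts$, sequence number) to all servers. Once $reg\_ts\ge t$, a server handles a BLOCK_REQ for $t$ by adding the record to its log and answering with $val[t]$. The reader waits until the blocks received contain $2f+1$ different blocks of some pair and, for the pair $(v,t)$ of highest timestamp with this property, $notOld(t)$ holds; it then returns $v$. The timestamp of the read is $t$. *Audit.* The writer asks all servers for their logs, waits for $n-f$ answers and returns all correctly signed records in them. **Histories.** For a finite execution $E$, let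 $H$ be the sequence of invocations and responses of the writes and of the reads by correct readers. A completion of a history is obtained by appending zero or more responses to pending invocations and discarding the remaining pending invocations. $H$ is *atomic* if for some completion there is a sequential history with the same operations such that (1) each read returns the value of the most recent preceding write, or $v_0$ if there is none; (2) if the response of $op_1$ occurs in the completion before the invocation of $op_2$, then $op_1$ precedes $op_2$ in the sequential history. Let ${\sf complete}(H)$ be the completion in which a pending write$(v)$ is completed if some complete read returns $v$, and every other pending invocation is removed. Let $\pi$ be obtained by listing the writes of ${\sf complete}(H)$ in the order in which they occur in $H$, and then inserting the complete reads one by one, in the order of their responses in $H$, a read with timestamp $t$ being placed immediately before the first write of timestamp greater than $t$, or at the end if there is none. **Theorem.** For every $f$, every initial value, every choice of at most $f$ Byzantine servers and of Byzantine readers, and every finite execution $E$ of the algorithm: if $op_1$ ends in $H$ before the invocation of $op_2$, where $op_1,op_2$ are operations of ${\sf complete}(H)$, then $op_1$ precedes $op_2$ in $\pi$. Moreover the writes in $\pi$ are in strictly increasing order of timestamp, ${\sf complete}(H)$ is a completion of $H$, and $\pi$ is a sequential history with the operations of ${\sf complete}(H)$ that satisfies (1) and (2) with respect to it. Hence $H$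 is atomic. -/

import Mathlib

namespace AuditableRegister

/-! ## Histories of a single-writer/multi-reader register and atomicity -/

/-- Register operations. The unique writer and every reader `r` are sequential; an operation is
identified by its invoker together with the invoker's own operation counter `k`. -/
inductive Op (R V : Type*)
  | write (k : ℕ) (v : V)
  | read (r : R) (k : ℕ)

/-- The value carried by a response. -/
inductive Ret (V : Type*)
  | ack
  | value (v : V)

/-- Invocation and response events. -/
inductive HEvent (R V : Type*)
  | inv (o : Op R V)
  | res (o : Op R V) (x : Ret V)

/-- The operation an event belongs to. -/
def HEvent.op {R V : Type*} : HEvent R V → Op R V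
  | .inv o => o
  | .res o _ => o

/-- `x` is a response of the right kind for the operation `o`. -/
def RetFits {R V : Type*} : Op R V → Ret V → Prop
  | .write _ _, .ack => True
  | .read _ _, .value _ => True
  | _, _ => False

/-- The operation `o` has a response in `H`. -/
def Responded {R V : Type*} (H : List (HEvent R V)) (o : Op R V) : Prop :=
  ∃ x, HEvent.res o x ∈ H

/-- The operation `o` is pending in `H`. -/
def Pending {R V : Type*} (H : List (HEvent R V)) (o : Op R V) : Prop :=
  HEvent.inv o ∈ H ∧ ¬ Responded H o

open Classical in
/-- Remove from `H` the invocations that have no response. -/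
noncomputable def dropPending {R V : Type*} (H : List (HEvent R V)) : List (HEvent R V) :=
  H.filter fun e => Responded H e.op

/-- `C` is obtained from `H` by appending zero or more responses to pending invocations and
discarding the remaining pending invocations. -/
def IsCompletion {R V : Type*} (H C : List (HEvent R V)) : Prop :=
  ∃ ext : List (HEvent R V),
    (∀ e ∈ ext, ∃ o x, e = HEvent.res o x ∧ Pending H o ∧ RetFits o x) ∧
    (ext.map HEvent.op).Nodup ∧
    C = dropPending (H ++ ext)

/-- Every invocation is immediately followed by the matching response. -/
inductive Sequential {R V : Type*} : List (HEvent R V) → Prop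
  | nil : Sequential []
  | cons (o : Op R V) (x : Ret V) (l : List (HEvent R V)) (h : Sequential l) :
      Sequential (HEvent.inv o :: HEvent.res o x :: l)

/-- Every read in the sequential history returns the value of the most recent preceding write,
or `cur` if there is none. -/
def Legal {R V : Type*} : V → List (HEvent R V) → Prop
  | _, [] => True
  | cur, .inv _ :: l => Legal cur l
  | _, .res (.write _ v) _ :: l => Legal v l
  | cur, .res (.read _ _) (.value v) :: l => v = cur ∧ Legal cur l
  | _, .res (.read _ _) .ack :: _ => False

/-- The response of `o₁` occurs in `H` before the invocation of `o₂`. -/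
def Precedes {R V : Type*} (H : List (HEvent R V)) (o₁ o₂ : Op R V) : Prop :=
  ∃ x, List.Sublist [HEvent.res o₁ x, HEvent.inv o₂] H

/-- `π` is a sequential history with the operations of the complete history `C`, in which reads
return the most recently written value and which preserves the real-time order of `C`. -/
structure IsLinearization {R V : Type*} (v₀ : V) (C π : List (HEvent R V)) : Prop where
  sequential : Sequential π
  sameOps : π.Perm C
  legal : Legal v₀ π
  realTime : ∀ o₁ o₂, Precedes C o₁ o₂ → Precedes π o₁ o₂

/-- Atomicity of a register history with initial value `v₀`. -/
def Atomic {R V : Type*} (v₀ : V) (H : List (HEvent R V)) : Prop :=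
  ∃ C π, IsCompletion H C ∧ IsLinearization v₀ C π

/-! ## Processes, blocks and messages -/

/-- The `n = 3f+1` servers. -/
abbrev Server (f : ℕ) : Type := Fin (3 * f + 1)

/-- The number `n` of servers. -/
abbrev numServers (f : ℕ) : ℕ := 3 * f + 1

/-- Processes: the writer (which is also the auditor), the servers, the readers. -/
inductive Proc (f : ℕ) (R : Type*)
  | writer
  | server (i : Server f)
  | reader (r : R)

/-- The `idx`-th block of the information dispersal of the pair (`val`, `ts`), treated
symbolically: correct processes look inside blocks only through `IsGetValue`. -/
structure Block (f : ℕ) (V : Type*) where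
  val : V
  ts : ℕ
  idx : Server f

/-- A block encrypted with the public key of the server `key`. -/
structure EncBlock (f : ℕ) (V : Type*) where
  key : Server f
  content : Block f V

/-- The `i`-th block is encrypted with the public key of the `i`-th server. -/
def generateBlocks {f : ℕ} {V : Type*} (v : V) (ts : ℕ) : Server f → EncBlock f V :=
  fun i => ⟨i, ⟨v, ts, i⟩⟩

/-- Decryption by server `i`: it succeeds exactly on blocks encrypted for server `i`. -/
def decrypt {f : ℕ} {V : Type*} (i : Server f) (e : EncBlock f V) : Option (Block f V) :=
  if e.key = i then some e.content else none

/-- The record (reader, timestamp, sequence number) together with the process that signed it. -/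
structure SignedRecord (f : ℕ) (R : Type*) where
  reader : R
  ts : ℕ
  nseq : ℕ
  signer : Proc f R

/-- The message that the writer reliably broadcasts in a write. -/
structure WriteMsg (f : ℕ) (V : Type*) where
  ts : ℕ
  blocks : Server f → EncBlock f V

/-- Point-to-point messages. -/
inductive Msg (f : ℕ) (R V : Type*)
  | writeAck (t : ℕ)
  | tsReq (num : ℕ)
  | tsResp (ts num : ℕ)
  | valReq (ts num : ℕ)
  | valResp (ts num : ℕ)
  | blockReq (rec : SignedRecord f R)
  | blockResp (b : Option (Block f V)) (ts num : ℕ)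
  | auditReq
  | auditResp (log : List (SignedRecord f R))

/-- A message in transit on the channel from `src` to `dst`. -/
structure Packet (f : ℕ) (R V : Type*) where
  src : Proc f R
  dst : Proc f R
  msg : Msg f R V

/-- The packets of "for `i` in `[1,n]` send `m` to server `i`". -/
def toAll {f : ℕ} {R V : Type*} (p : Proc f R) (m : Msg f R V) : Multiset (Packet f R V) :=
  (Finset.univ : Finset (Server f)).val.map fun i => ⟨p, .server i, m⟩

/-- The number of servers with a property. -/
noncomputable def countServers {f : ℕ} (P : Server f → Prop) : ℕ := {i | P i}.ncard

/-! ## Local states -/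

inductive WriterPhase (V : Type*)
  | idle
  | writing (v : V)
  | auditing

/-- `acks i = none` stands for `⊥`. `collectedLog i = none` says that nothing was received from
server `i` during the current audit, and `some []` that an empty log was received. -/
structure WriterState (f : ℕ) (R V : Type*) where
  ts : ℕ
  acks : Server f → Option ℕ
  collectedLog : Server f → Option (List (SignedRecord f R))
  phase : WriterPhase V
  crashed : Bool

/-- `val ts` is the block stored for the timestamp `ts`, if any. `pendingVal` and `pendingBlock`
hold the received `VAL_REQ` and `BLOCK_REQ` requests whose "wait for" has not ended. -/
structure ServerState (f : ℕ) (R V : Type*) where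
  regTs : ℕ
  val : ℕ → Option (Block f V)
  log : List (SignedRecord f R)
  pendingVal : Multiset (R × ℕ × ℕ)
  pendingBlock : Multiset (SignedRecord f R)

/-- `collecting`: before the `BLOCK_REQ` messages are sent; `fetching`: after that, until the read
returns. -/
inductive ReaderPhase
  | idle
  | collecting
  | fetching

structure ReaderState (f : ℕ) (V : Type*) where
  nseq : ℕ
  collectedTs : Server f → Finset ℕ
  collectedBlocks : Server f → Set (Option (Block f V) × ℕ)
  minTs : Option ℕ
  phase : ReaderPhase

/-- `|{i : min (Collected_ts[i]) ≤ ts}| ≥ 2f+1`; a server from which nothing was received does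
not count. -/
def NotOld {f : ℕ} (T : Server f → Finset ℕ) (ts : ℕ) : Prop :=
  2 * f + 1 ≤ countServers fun i => ∃ t ∈ T i, t ≤ ts

/-- `min {ts ∈ Collected_ts | notOld ts}`; the set is nonempty when timestamps of at least
`n - f = 2f+1` servers were collected. -/
noncomputable def leastNotOld {f : ℕ} (T : Server f → Finset ℕ) : ℕ :=
  sInf {t | (∃ i, t ∈ T i) ∧ NotOld T t}

/-- The collected blocks contain `τ = 2f+1` different blocks of the pair `(v, ts)`. -/
def Decodable {f : ℕ} {V : Type*} (B : Server f → Set (Option (Block f V) × ℕ))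
    (v : V) (ts : ℕ) : Prop :=
  2 * f + 1 ≤ countServers fun i => (some ⟨v, ts, i⟩, ts) ∈ B i

/-- `GetValue (Collected_blocks) = (v, ts)`: the decodable pair with the highest timestamp. -/
def IsGetValue {f : ℕ} {V : Type*} (B : Server f → Set (Option (Block f V) × ℕ))
    (v : V) (ts : ℕ) : Prop :=
  Decodable B v ts ∧ ∀ v' ts', Decodable B v' ts' → ts' ≤ ts

/-! ## Handlers of the correct processes -/

/-- Server `i` delivers a message broadcast by the writer. -/
def ServerState.onWrite {f : ℕ} {R V : Type*} (s : ServerState f R V) (i : Server f)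
    (m : WriteMsg f V) : ServerState f R V :=
  { s with
    val := Function.update s.val m.ts (decrypt i (m.blocks i))
    regTs := if s.regTs < m.ts then m.ts else s.regTs }

/-- The writer receives an acknowledgement from server `i`. -/
def WriterState.onAck {f : ℕ} {R V : Type*} (w : WriterState f R V) (i : Server f) (t : ℕ) :
    WriterState f R V :=
  if w.ts = t then { w with acks := Function.update w.acks i (some t) } else w

/-- Start of a read: all variables but `nseq` are reset. -/
def ReaderState.start {f : ℕ} {V : Type*} (q : ReaderState f V) : ReaderState f V where
  nseq := q.nseq + 1
  collectedTs := fun _ => ∅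
  collectedBlocks := fun _ => ∅
  minTs := none
  phase := .collecting

/-- Add a timestamp received from server `i`. -/
def ReaderState.addTs {f : ℕ} {V : Type*} (q : ReaderState f V) (i : Server f) (t : ℕ) :
    ReaderState f V :=
  { q with collectedTs := Function.update q.collectedTs i (insert t (q.collectedTs i)) }

/-- The reader receives `(VAL_RESP, t, num)` from server `i`. -/
def ReaderState.onValResp {f : ℕ} {V : Type*} (q : ReaderState f V) (i : Server f) (t num : ℕ) :
    ReaderState f V :=
  if num = q.nseq then q.addTs i t else q

/-- The test made when `(TS_RESP, t, num)` from server `i` is received: the sequence number is the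
current one and timestamps of at least `n - f` servers are now collected. -/
def ReaderState.TsQuorum {f : ℕ} {V : Type*} (q : ReaderState f V) (i : Server f) (t num : ℕ) :
    Prop :=
  num = q.nseq ∧ numServers f - f ≤ countServers fun j => ((q.addTs i t).collectedTs j).Nonempty

open Classical in
/-- The reader receives `(TS_RESP, t, num)` from server `i`: its new state. -/
noncomputable def ReaderState.onTsResp {f : ℕ} {V : Type*} (q : ReaderState f V) (i : Server f)
    (t num : ℕ) : ReaderState f V :=
  if q.TsQuorum i t num then
    { q.addTs i t with minTs := some (leastNotOld (q.addTs i t).collectedTs) }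
  else if num = q.nseq then q.addTs i t else q

open Classical in
/-- The reader `r` receives `(TS_RESP, t, num)` from server `i`: the messages it sends. -/
noncomputable def tsRespSends {f : ℕ} {R V : Type*} (r : R) (q : ReaderState f V) (i : Server f)
    (t num : ℕ) : Multiset (Packet f R V) :=
  if q.TsQuorum i t num then
    toAll (.reader r) (.valReq (leastNotOld (q.addTs i t).collectedTs) q.nseq)
  else 0

/-- The reader receives `(BLOCK_RESP, b, t, num)` from server `i`. -/
def ReaderState.onBlockResp {f : ℕ} {V : Type*} (q : ReaderState f V) (i : Server f)
    (b : Option (Block f V)) (t num : ℕ) : ReaderState f V :=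
  if num = q.nseq then
    { q with
      collectedBlocks := Function.update q.collectedBlocks i (insert (b, t) (q.collectedBlocks i)) }
  else q

/-- The answer of an audit: the records of the collected logs that carry the signature of the
reader they are about. -/
def auditAnswer {f : ℕ} {R : Type*} (L : Server f → Option (List (SignedRecord f R))) :
    Set (SignedRecord f R) :=
  {rec | rec.signer = .reader rec.reader ∧ ∃ i, ∃ l, L i = some l ∧ rec ∈ l}

/-! ## The system -/

/-- A global configuration. `net` holds the point-to-point messages in transit, `bcast` the
messages broadcast by the writer, `delivered i` those of them that server `i` has delivered. -/
structure Config (f : ℕ) (R V : Type*) where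
  writer : WriterState f R V
  servers : Server f → ServerState f R V
  readers : R → ReaderState f V
  net : Multiset (Packet f R V)
  bcast : Set (WriteMsg f V)
  delivered : Server f → Set (WriteMsg f V)

/-- Initially every server holds its block of the initial value `v₀`, with timestamp `0`. -/
def Config.initial (f : ℕ) (R : Type*) {V : Type*} (v₀ : V) : Config f R V where
  writer := ⟨0, fun _ => none, fun _ => none, .idle, false⟩
  servers := fun i => ⟨0, fun t => if t = 0 then some ⟨v₀, 0, i⟩ else none, [], 0, 0⟩
  readers := fun _ => ⟨0, fun _ => ∅, fun _ => ∅, none, .idle⟩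
  net := 0
  bcast := ∅
  delivered := fun _ => ∅

/-- Labels of steps. A write carries its timestamp, a read its sequence number; the response of a
read also records the pair `(v, ts)` obtained from `GetValue`. -/
inductive Label (f : ℕ) (R V : Type*)
  | writeInv (ts : ℕ) (v : V)
  | writeRes (ts : ℕ) (v : V)
  | readInv (r : R) (n : ℕ)
  | readRes (r : R) (n : ℕ) (v : V) (ts : ℕ)
  | auditInv
  | auditRes (ans : Set (SignedRecord f R))
  | deliver (i : Server f) (m : WriteMsg f V)
  | receive (p : Packet f R V)
  | silent

/-- The Byzantine processes, given the Byzantine servers and readers; the writer can only crash. -/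
def IsByzantine {f : ℕ} {R : Type*} (byzS : Finset (Server f)) (byzR : Set R) : Proc f R → Prop
  | .writer => False
  | .server i => i ∈ byzS
  | .reader r => r ∈ byzR

/-- One step of the system. Correct processes execute the algorithm; Byzantine processes send
arbitrary messages, but only in their own name. A "wait" is a separate step that may be taken at
any time at which its condition holds. -/
inductive Step {f : ℕ} {R V : Type*} [DecidableEq R] (byzS : Finset (Server f)) (byzR : Set R) :
    Config f R V → Label f R V → Config f R V → Prop
  /- The writer. -/
  | writeInvoke (c : Config f R V) (v : V)
      (hc : c.writer.crashed = false) (hp : c.writer.phase = .idle) :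
      Step byzS byzR c (.writeInv (c.writer.ts + 1) v)
        { c with
          writer := { c.writer with ts := c.writer.ts + 1, phase := .writing v }
          bcast := insert ⟨c.writer.ts + 1, generateBlocks v (c.writer.ts + 1)⟩ c.bcast }
  | writeAck (c : Config f R V) (i : Server f) (t : ℕ) (rest : Multiset (Packet f R V))
      (hc : c.writer.crashed = false)
      (hn : c.net = ⟨.server i, .writer, .writeAck t⟩ ::ₘ rest) :
      Step byzS byzR c (.receive ⟨.server i, .writer, .writeAck t⟩)
        { c with writer := c.writer.onAck i t, net := rest }
  | writeReturn (c : Config f R V) (v : V)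
      (hc : c.writer.crashed = false) (hp : c.writer.phase = .writing v)
      (hq : numServers f - f ≤ countServers fun i => c.writer.acks i = some c.writer.ts) :
      Step byzS byzR c (.writeRes c.writer.ts v)
        { c with writer := { c.writer with phase := .idle } }
  | auditInvoke (c : Config f R V)
      (hc : c.writer.crashed = false) (hp : c.writer.phase = .idle) :
      Step byzS byzR c .auditInv
        { c with
          writer := { c.writer with collectedLog := fun _ => none, phase := .auditing }
          net := toAll .writer .auditReq + c.net }
  | auditResp (c : Config f R V) (i : Server f) (l : List (SignedRecord f R))
      (rest : Multiset (Packet f R V))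
      (hc : c.writer.crashed = false)
      (hn : c.net = ⟨.server i, .writer, .auditResp l⟩ ::ₘ rest) :
      Step byzS byzR c (.receive ⟨.server i, .writer, .auditResp l⟩)
        { c with
          writer := { c.writer with
            collectedLog := Function.update c.writer.collectedLog i (some l) }
          net := rest }
  | auditReturn (c : Config f R V)
      (hc : c.writer.crashed = false) (hp : c.writer.phase = .auditing)
      (hq : numServers f - f ≤ countServers fun i => c.writer.collectedLog i ≠ none) :
      Step byzS byzR c (.auditRes (auditAnswer c.writer.collectedLog))
        { c with writer := { c.writer with phase := .idle } }
  | writerCrash (c : Config f R V) :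
      Step byzS byzR c .silent { c with writer := { c.writer with crashed := true } }
  /- Correct servers. -/
  | deliver (c : Config f R V) (i : Server f) (m : WriteMsg f V)
      (hi : i ∉ byzS) (hm : m ∈ c.bcast) (hd : m ∉ c.delivered i) :
      Step byzS byzR c (.deliver i m)
        { c with
          servers := Function.update c.servers i ((c.servers i).onWrite i m)
          net := ⟨.server i, .writer, .writeAck m.ts⟩ ::ₘ c.net
          delivered := Function.update c.delivered i (insert m (c.delivered i)) }
  | tsReq (c : Config f R V) (i : Server f) (r : R) (num : ℕ) (rest : Multiset (Packet f R V))
      (hi : i ∉ byzS) (hn : c.net = ⟨.reader r, .server i, .tsReq num⟩ ::ₘ rest) :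
      Step byzS byzR c (.receive ⟨.reader r, .server i, .tsReq num⟩)
        { c with net := ⟨.server i, .reader r, .tsResp (c.servers i).regTs num⟩ ::ₘ rest }
  | valReq (c : Config f R V) (i : Server f) (r : R) (t num : ℕ) (rest : Multiset (Packet f R V))
      (hi : i ∉ byzS) (hn : c.net = ⟨.reader r, .server i, .valReq t num⟩ ::ₘ rest) :
      Step byzS byzR c (.receive ⟨.reader r, .server i, .valReq t num⟩)
        { c with
          servers := Function.update c.servers i
            { c.servers i with pendingVal := (r, t, num) ::ₘ (c.servers i).pendingVal }
          net := rest }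
  | valAnswer (c : Config f R V) (i : Server f) (r : R) (t num : ℕ)
      (rest : Multiset (R × ℕ × ℕ))
      (hi : i ∉ byzS) (hn : (c.servers i).pendingVal = (r, t, num) ::ₘ rest)
      (ht : t ≤ (c.servers i).regTs) :
      Step byzS byzR c .silent
        { c with
          servers := Function.update c.servers i { c.servers i with pendingVal := rest }
          net := ⟨.server i, .reader r, .valResp t num⟩ ::ₘ c.net }
  | blockReq (c : Config f R V) (i : Server f) (rec : SignedRecord f R)
      (rest : Multiset (Packet f R V))
      (hi : i ∉ byzS) (hs : rec.signer = .reader rec.reader)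
      (hn : c.net = ⟨.reader rec.reader, .server i, .blockReq rec⟩ ::ₘ rest) :
      Step byzS byzR c (.receive ⟨.reader rec.reader, .server i, .blockReq rec⟩)
        { c with
          servers := Function.update c.servers i
            { c.servers i with pendingBlock := rec ::ₘ (c.servers i).pendingBlock }
          net := rest }
  | blockAnswer (c : Config f R V) (i : Server f) (rec : SignedRecord f R)
      (rest : Multiset (SignedRecord f R))
      (hi : i ∉ byzS) (hn : (c.servers i).pendingBlock = rec ::ₘ rest)
      (ht : rec.ts ≤ (c.servers i).regTs) :
      Step byzS byzR c .silent
        { c with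
          servers := Function.update c.servers i
            { c.servers i with pendingBlock := rest, log := rec :: (c.servers i).log }
          net := ⟨.server i, .reader rec.reader,
            .blockResp ((c.servers i).val rec.ts) rec.ts rec.nseq⟩ ::ₘ c.net }
  | auditReq (c : Config f R V) (i : Server f) (rest : Multiset (Packet f R V))
      (hi : i ∉ byzS) (hn : c.net = ⟨.writer, .server i, .auditReq⟩ ::ₘ rest) :
      Step byzS byzR c (.receive ⟨.writer, .server i, .auditReq⟩)
        { c with net := ⟨.server i, .writer, .auditResp (c.servers i).log⟩ ::ₘ rest }
  /- Correct readers. -/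
  | readInvoke (c : Config f R V) (r : R)
      (hr : r ∉ byzR) (hp : (c.readers r).phase = .idle) :
      Step byzS byzR c (.readInv r ((c.readers r).nseq + 1))
        { c with
          readers := Function.update c.readers r (c.readers r).start
          net := toAll (.reader r) (.tsReq ((c.readers r).nseq + 1)) + c.net }
  | tsResp (c : Config f R V) (r : R) (i : Server f) (t num : ℕ) (rest : Multiset (Packet f R V))
      (hr : r ∉ byzR) (hn : c.net = ⟨.server i, .reader r, .tsResp t num⟩ ::ₘ rest) :
      Step byzS byzR c (.receive ⟨.server i, .reader r, .tsResp t num⟩)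
        { c with
          readers := Function.update c.readers r ((c.readers r).onTsResp i t num)
          net := tsRespSends r (c.readers r) i t num + rest }
  | valResp (c : Config f R V) (r : R) (i : Server f) (t num : ℕ) (rest : Multiset (Packet f R V))
      (hr : r ∉ byzR) (hn : c.net = ⟨.server i, .reader r, .valResp t num⟩ ::ₘ rest) :
      Step byzS byzR c (.receive ⟨.server i, .reader r, .valResp t num⟩)
        { c with
          readers := Function.update c.readers r ((c.readers r).onValResp i t num)
          net := rest }
  | blockRequest (c : Config f R V) (r : R) (m : ℕ)
      (hr : r ∉ byzR) (hp : (c.readers r).phase = .collecting)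
      (hm : (c.readers r).minTs = some m)
      (hq : f + 1 ≤ countServers fun i => m ∈ (c.readers r).collectedTs i) :
      Step byzS byzR c .silent
        { c with
          readers := Function.update c.readers r { c.readers r with phase := .fetching }
          net := toAll (.reader r) (.blockReq ⟨r, m, (c.readers r).nseq, .reader r⟩) + c.net }
  | blockResp (c : Config f R V) (r : R) (i : Server f) (b : Option (Block f V)) (t num : ℕ)
      (rest : Multiset (Packet f R V))
      (hr : r ∉ byzR) (hn : c.net = ⟨.server i, .reader r, .blockResp b t num⟩ ::ₘ rest) :
      Step byzS byzR c (.receive ⟨.server i, .reader r, .blockResp b t num⟩)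
        { c with
          readers := Function.update c.readers r ((c.readers r).onBlockResp i b t num)
          net := rest }
  | readReturn (c : Config f R V) (r : R) (v : V) (ts : ℕ)
      (hr : r ∉ byzR) (hp : (c.readers r).phase = .fetching)
      (hv : IsGetValue (c.readers r).collectedBlocks v ts)
      (ho : NotOld (c.readers r).collectedTs ts) :
      Step byzS byzR c (.readRes r (c.readers r).nseq v ts)
        { c with readers := Function.update c.readers r { c.readers r with phase := .idle } }
  /- Byzantine servers and readers. -/
  | byzSend (c : Config f R V) (p q : Proc f R) (m : Msg f R V) (hp : IsByzantine byzS byzR p) :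
      Step byzS byzR c .silent { c with net := ⟨p, q, m⟩ ::ₘ c.net }
  | byzReceive (c : Config f R V) (p : Packet f R V) (rest : Multiset (Packet f R V))
      (hp : IsByzantine byzS byzR p.dst) (hn : c.net = p ::ₘ rest) :
      Step byzS byzR c (.receive p) { c with net := rest }

/-- `Run v₀ byzS byzR E c`: the sequence of steps `E` leads from the initial configuration to `c`. -/
inductive Run {f : ℕ} {R V : Type*} [DecidableEq R] (v₀ : V) (byzS : Finset (Server f))
    (byzR : Set R) : List (Label f R V) → Config f R V → Prop
  | start : Run v₀ byzS byzR [] (Config.initial f R v₀)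
  | step (E : List (Label f R V)) (c d : Config f R V) (l : Label f R V)
      (h : Run v₀ byzS byzR E c) (hs : Step byzS byzR c l d) : Run v₀ byzS byzR (E ++ [l]) d

/-- `E` is an execution of the algorithm. -/
def IsExecution {f : ℕ} {R V : Type*} [DecidableEq R] (v₀ : V) (byzS : Finset (Server f))
    (byzR : Set R) (E : List (Label f R V)) : Prop :=
  ∃ c, Run v₀ byzS byzR E c

/-! ## The history of an execution and its linearization -/

/-- The read/write event of a step, if any. -/
def Label.event {f : ℕ} {R V : Type*} : Label f R V → Option (HEvent R V)
  | .writeInv k v => some (.inv (.write k v))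
  | .writeRes k v => some (.res (.write k v) .ack)
  | .readInv r n => some (.inv (.read r n))
  | .readRes r n v _ => some (.res (.read r n) (.value v))
  | _ => none

/-- The register history of an execution. -/
def history {f : ℕ} {R V : Type*} (E : List (Label f R V)) : List (HEvent R V) :=
  E.filterMap Label.event

/-- `o` is a write of a value that some complete read of `H` returns. -/
def WritesReturnedValue {R V : Type*} (H : List (HEvent R V)) : Op R V → Prop
  | .write _ v => ∃ r n, HEvent.res (.read r n) (.value v) ∈ H
  | .read _ _ => False

/-- The operation invoked by an event, if the event is an invocation. -/
def HEvent.invoked {R V : Type*} : HEvent R V → Option (Op R V)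
  | .inv o => some o
  | .res _ _ => none

open Classical in
/-- `complete(H)`: a pending write of a value that a complete read returns is completed; all other
pending invocations are removed. -/
noncomputable def completeHistory {R V : Type*} (H : List (HEvent R V)) : List (HEvent R V) :=
  dropPending (H ++ ((H.filterMap HEvent.invoked).filter fun o =>
    Pending H o ∧ WritesReturnedValue H o).map fun o => HEvent.res o .ack)

/-- The write started by an event, as a completed operation. -/
def HEvent.startedWrite {R V : Type*} : HEvent R V → Option (Op R V × Ret V)
  | .inv (.write k v) => some (.write k v, .ack)
  | _ => none

/-- The read completed by a step, with the timestamp of the value it returns. -/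
def Label.returnedRead {f : ℕ} {R V : Type*} : Label f R V → Option ((Op R V × Ret V) × ℕ)
  | .readRes r n v ts => some ((.read r n, .value v), ts)
  | _ => none

/-- Insert a read with timestamp `ts` immediately before the first write whose timestamp exceeds
`ts`, or at the end if there is no such write. -/
def insertRead {R V : Type*} (rd : Op R V × Ret V) (ts : ℕ) :
    List (Op R V × Ret V) → List (Op R V × Ret V)
  | [] => [rd]
  | (.write k v, x) :: l =>
      if ts < k then rd :: (.write k v, x) :: l else (.write k v, x) :: insertRead rd ts l
  | (.read r n, x) :: l => (.read r n, x) :: insertRead rd ts l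

/-- The operations of `π` in order: first all writes of `complete(H)` in the order in which they
occur in `H`; then the complete reads are inserted one by one in the order of their responses. -/
noncomputable def linearizedOps {f : ℕ} {R V : Type*} (E : List (Label f R V)) :
    List (Op R V × Ret V) :=
  (E.filterMap Label.returnedRead).foldl (fun l rd => insertRead rd.1 rd.2 l)
    ((completeHistory (history E)).filterMap HEvent.startedWrite)

/-- The sequential history `π`. -/
noncomputable def linearization {f : ℕ} {R V : Type*} (E : List (Label f R V)) :
    List (HEvent R V) :=
  (linearizedOps E).flatMap fun o => [HEvent.inv o.1, HEvent.res o.1 o.2]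

/-- The timestamp of an operation of `π` that is a write. -/
def writeTimestamp {R V : Type*} : Op R V × Ret V → Option ℕ
  | (.write k _, _) => some k
  | (.read _ _, _) => none

end AuditableRegister

namespace AuditableRegister

/-! ## Quorums -/

/-! Everything rests on one counting fact: two sets of `2f+1` servers among `3f+1` share at least
`f+1` servers, hence a correct one (`exists_correct_of_quorums`).

Authenticity: `2f+1` blocks of one pair include a block from a correct server, whose stored blocks
come from the writer or the initial state. So a read returns an authored pair
(`BlocksInv.of_decodable`).

Persistence: when an operation with timestamp `k` completes, there is a quorum whose correct members
have `regTs ≥ k` (`Stable`). For a write the acknowledgements show this; for a read, the blocks of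
the returned pair do, since a correct server sends a block for `t` only after reaching `t`. This
persists because `regTs` never decreases.

Monotonicity: let a read start afterwards. The correct servers of that quorum answer `TS_REQ` with
timestamps at least `k`. Their `VAL_RESP` answers echo timestamps requested by the reader, and each
such timestamp is `NotOld`. A `NotOld` timestamp dominates one collected from a correct server of
the quorum, so it is at least `k` as well. The apparent circularity is an induction over steps
(`ReadBound.step`). The `NotOld` test at the return of the read then bounds its timestamp below by
`k`. If the later operation is a write, its timestamp is fresh and exceeds every authored one.

The rest is combinatorics on the trace. Each read timestamp is `0` or that of a completed write, so
the insertions keep the list sorted by timestamp, each write ahead of the reads that share its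
timestamp and such reads in response order (`isMerge_foldl_insertRead`). Sortedness makes the list
legal (`legal_sequentialHistory`), and with the inequalities above it respects real time
(`TraceInv.precedes_linearization`). -/

theorem countServers_mono {f : ℕ} {P Q : Server f → Prop} (h : ∀ i, P i → Q i) :
    countServers P ≤ countServers Q :=
  Set.ncard_le_ncard h (Set.toFinite _)

/-- Inclusion–exclusion: the overlap has at least `2(2f+1) - (3f+1) = f+1` elements, too many to be
all Byzantine. -/
theorem exists_correct_of_quorums {f : ℕ} {byzS : Finset (Server f)} (hbyz : byzS.card ≤ f)
    {P Q : Server f → Prop} (hP : 2 * f + 1 ≤ countServers P) (hQ : 2 * f + 1 ≤ countServers Q) :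
    ∃ i, i ∉ byzS ∧ P i ∧ Q i := by
  classical
  by_contra! hno
  have hsub : {i | P i} ∩ {i | Q i} ⊆ (byzS : Set (Server f)) := by
    rintro i ⟨hp, hq⟩
    by_contra hi
    exact hno i hi hp hq
  have h1 := Set.ncard_le_ncard hsub (Set.toFinite _)
  rw [Set.ncard_coe_finset] at h1
  have h2 := Set.ncard_union_add_ncard_inter {i | P i} {i | Q i} (Set.toFinite _) (Set.toFinite _)
  have h3 := Set.ncard_le_card ({i | P i} ∪ {i | Q i})
  rw [Nat.card_eq_fintype_card, Fintype.card_fin] at h3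
  unfold countServers at hP hQ
  omega

/-- The largest collected timestamp is `NotOld`, so the infimum is over a nonempty set and is
attained, instead of being the default `0`. Safety uses only this; minimality plays no role. -/
theorem notOld_leastNotOld {f : ℕ} {T : Server f → Finset ℕ}
    (h : 2 * f + 1 ≤ countServers fun j => (T j).Nonempty) : NotOld T (leastNotOld T) := by
  classical
  have hne : {t | (∃ i, t ∈ T i) ∧ NotOld T t}.Nonempty := by
    have hU : (Finset.univ.biUnion T).Nonempty := by
      obtain ⟨i, hi⟩ : {j | (T j).Nonempty}.Nonempty := by
        exact Set.nonempty_of_ncard_ne_zero (Nat.ne_of_gt (Nat.lt_of_lt_of_le (Nat.succ_pos _) h))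
      obtain ⟨t, ht⟩ := hi
      exact ⟨t, Finset.mem_biUnion.2 ⟨i, Finset.mem_univ _, ht⟩⟩
    refine ⟨(Finset.univ.biUnion T).max' hU, ?_, ?_⟩
    · obtain ⟨i, -, hi⟩ := Finset.mem_biUnion.1 (Finset.max'_mem _ hU)
      exact ⟨i, hi⟩
    · refine h.trans (countServers_mono ?_)
      rintro i ⟨t, ht⟩
      exact ⟨t, ht, Finset.le_max' _ _ (Finset.mem_biUnion.2 ⟨i, Finset.mem_univ _, ht⟩)⟩
  exact (Nat.sInf_mem hne).2

/-! ## Effect of a single step -/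

section StepLemmas

variable {f : ℕ} {R V : Type*} {byzS : Finset (Server f)} {byzR : Set R}
  {c d : Config f R V} {l : Label f R V}

theorem regTs_le_onWrite (s : ServerState f R V) (i : Server f) (m : WriteMsg f V) :
    s.regTs ≤ (s.onWrite i m).regTs ∧ m.ts ≤ (s.onWrite i m).regTs := by
  simp only [ServerState.onWrite]
  split_ifs <;> omega

theorem nseq_onTsResp (q : ReaderState f V) (i : Server f) (t num : ℕ) :
    (q.onTsResp i t num).nseq = q.nseq ∧ (q.onTsResp i t num).phase = q.phase := by
  simp only [ReaderState.onTsResp, ReaderState.addTs]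
  split_ifs <;> exact ⟨rfl, rfl⟩

theorem nseq_onValResp (q : ReaderState f V) (i : Server f) (t num : ℕ) :
    (q.onValResp i t num).nseq = q.nseq ∧ (q.onValResp i t num).phase = q.phase := by
  simp only [ReaderState.onValResp, ReaderState.addTs]
  split_ifs <;> exact ⟨rfl, rfl⟩

theorem nseq_onBlockResp (q : ReaderState f V) (i : Server f) (b : Option (Block f V))
    (t num : ℕ) :
    (q.onBlockResp i b t num).nseq = q.nseq ∧ (q.onBlockResp i b t num).phase = q.phase := by
  simp only [ReaderState.onBlockResp]
  split_ifs <;> exact ⟨rfl, rfl⟩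

theorem ts_onAck (w : WriterState f R V) (i : Server f) (t : ℕ) :
    (w.onAck i t).ts = w.ts ∧ (w.onAck i t).phase = w.phase := by
  simp only [WriterState.onAck]
  split_ifs <;> exact ⟨rfl, rfl⟩

theorem ReaderState.TsQuorum.two_mul_add_one_le {q : ReaderState f V} {i : Server f} {t num : ℕ}
    (h : q.TsQuorum i t num) :
    2 * f + 1 ≤ countServers fun j => ((q.addTs i t).collectedTs j).Nonempty := by
  refine le_trans ?_ h.2
  unfold numServers
  omega

theorem mem_collectedTs_addTs {q : ReaderState f V} {i j : Server f} {s t : ℕ}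
    (h : t ∈ (q.addTs i s).collectedTs j) : t ∈ q.collectedTs j ∨ (i = j ∧ t = s) := by
  simp only [ReaderState.addTs, Function.update_apply] at h
  split_ifs at h with hj
  · subst hj
    rcases Finset.mem_insert.1 h with h | h
    · exact Or.inr ⟨rfl, h⟩
    · exact Or.inl h
  · exact Or.inl h

theorem mem_collectedTs_onTsResp {q : ReaderState f V} {i j : Server f} {s t num : ℕ}
    (h : t ∈ (q.onTsResp i s num).collectedTs j) :
    t ∈ q.collectedTs j ∨ (i = j ∧ t = s ∧ num = q.nseq) := by
  simp only [ReaderState.onTsResp] at h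
  split_ifs at h with h1 h2
  · rcases mem_collectedTs_addTs h with h | ⟨h, h'⟩
    · exact Or.inl h
    · exact Or.inr ⟨h, h', h1.1⟩
  · rcases mem_collectedTs_addTs h with h | ⟨h, h'⟩
    · exact Or.inl h
    · exact Or.inr ⟨h, h', h2⟩
  · exact Or.inl h

theorem mem_collectedTs_onValResp {q : ReaderState f V} {i j : Server f} {s t num : ℕ}
    (h : t ∈ (q.onValResp i s num).collectedTs j) :
    t ∈ q.collectedTs j ∨ (i = j ∧ t = s ∧ num = q.nseq) := by
  simp only [ReaderState.onValResp] at h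
  split_ifs at h with h2
  · rcases mem_collectedTs_addTs h with h | ⟨h, h'⟩
    · exact Or.inl h
    · exact Or.inr ⟨h, h', h2⟩
  · exact Or.inl h

variable [DecidableEq R]

theorem Step.regTs_mono (hs : Step byzS byzR c l d) (j : Server f) :
    (c.servers j).regTs ≤ (d.servers j).regTs := by
  cases hs <;> try exact le_rfl
  case deliver i m hi hm hd =>
    by_cases h : j = i
    · subst h
      simpa using (regTs_le_onWrite _ _ _).1
    · simp [h]
  all_goals
    simp only [Function.update_apply]
    split_ifs with h
    · subst h
      exact le_rfl
    · exact le_rfl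

theorem Step.nseq_mono (hs : Step byzS byzR c l d) (r : R) :
    (c.readers r).nseq ≤ (d.readers r).nseq := by
  cases hs <;> try exact le_rfl
  all_goals
    simp only [Function.update_apply]
    split_ifs with h
    · subst h
      simp [nseq_onTsResp, nseq_onValResp, nseq_onBlockResp, ReaderState.start]
    · exact le_rfl

/-- The sequence number changes only when a read starts, and the sets are emptied then. Hence a
timestamp present after the step belongs to the read that was already running. -/
theorem Step.mem_collectedTs (hs : Step byzS byzR c l d) {r : R} {j : Server f} {t : ℕ}
    (h : t ∈ (d.readers r).collectedTs j) :
    (d.readers r).nseq = (c.readers r).nseq ∧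
      (t ∈ (c.readers r).collectedTs j ∨
        ⟨.server j, .reader r, .tsResp t (c.readers r).nseq⟩ ∈ c.net ∨
        ⟨.server j, .reader r, .valResp t (c.readers r).nseq⟩ ∈ c.net) := by
  cases hs <;> try exact ⟨rfl, Or.inl h⟩
  all_goals
    simp only [Function.update_apply] at h ⊢
    split_ifs at h ⊢ with hr' <;> try exact ⟨rfl, Or.inl h⟩
    subst hr'
  · simp [ReaderState.start] at h
  · rename_i hn
    refine ⟨(nseq_onTsResp _ _ _ _).1, ?_⟩
    rcases mem_collectedTs_onTsResp h with h | ⟨rfl, rfl, rfl⟩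
    · exact Or.inl h
    · exact Or.inr (Or.inl (by rw [hn]; exact Multiset.mem_cons_self _ _))
  · rename_i hn
    refine ⟨(nseq_onValResp _ _ _ _).1, ?_⟩
    rcases mem_collectedTs_onValResp h with h | ⟨rfl, rfl, rfl⟩
    · exact Or.inl h
    · exact Or.inr (Or.inr (by rw [hn]; exact Multiset.mem_cons_self _ _))
  · exact ⟨rfl, Or.inl h⟩
  · refine ⟨(nseq_onBlockResp _ _ _ _ _).1, Or.inl ?_⟩
    simp only [ReaderState.onBlockResp] at h
    split_ifs at h <;> exact h
  · exact ⟨rfl, Or.inl h⟩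

/-- The sequence number can be forgotten: authenticity of a block and the bound on `regTs` do not
depend on which read asked for it. -/
theorem Step.mem_collectedBlocks (hs : Step byzS byzR c l d) {r : R} {j : Server f}
    {b : Option (Block f V)} {t : ℕ} (h : (b, t) ∈ (d.readers r).collectedBlocks j) :
    (b, t) ∈ (c.readers r).collectedBlocks j ∨
      ∃ num, ⟨.server j, .reader r, .blockResp b t num⟩ ∈ c.net := by
  cases hs <;> try exact Or.inl h
  all_goals
    simp only [Function.update_apply] at h ⊢
    split_ifs at h ⊢ with hr' <;> try exact Or.inl h
    subst hr'
  · simp [ReaderState.start] at h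
  · simp only [ReaderState.onTsResp, ReaderState.addTs] at h
    split_ifs at h <;> exact Or.inl h
  · simp only [ReaderState.onValResp, ReaderState.addTs] at h
    split_ifs at h <;> exact Or.inl h
  · exact Or.inl h
  · rename_i num rest hr hn
    simp only [ReaderState.onBlockResp] at h
    split_ifs at h with h1
    · simp only [Function.update_apply] at h
      split_ifs at h with h2
      · subst h2
        rcases h with h | h
        · obtain ⟨rfl, rfl⟩ := Prod.mk.inj h
          exact Or.inr ⟨num, by rw [hn]; exact Multiset.mem_cons_self _ _⟩
        · exact Or.inl h
      · exact Or.inl h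
    · exact Or.inl h
  · exact Or.inl h

theorem Step.mem_pendingVal (hs : Step byzS byzR c l d) {i : Server f} {r : R} {t num : ℕ}
    (h : (r, t, num) ∈ (d.servers i).pendingVal) :
    (r, t, num) ∈ (c.servers i).pendingVal ∨
      ⟨.reader r, .server i, .valReq t num⟩ ∈ c.net := by
  cases hs <;> try exact Or.inl h
  all_goals
    simp only [Function.update_apply] at h ⊢
    split_ifs at h ⊢ with hi' <;> try exact Or.inl h
    subst hi'
  · exact Or.inl h
  · rename_i hn
    rcases Multiset.mem_cons.1 h with h | h
    · simp only [Prod.mk.injEq] at h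
      obtain ⟨rfl, rfl, rfl⟩ := h
      exact Or.inr (by rw [hn]; exact Multiset.mem_cons_self _ _)
    · exact Or.inl h
  · rename_i hn _
    exact Or.inl (by rw [hn]; exact Multiset.mem_cons_of_mem h)
  · exact Or.inl h
  · exact Or.inl h

theorem Step.acks_eq (hs : Step byzS byzR c l d) {i : Server f} {t : ℕ}
    (h : d.writer.acks i = some t) :
    c.writer.acks i = some t ∨ ⟨.server i, .writer, .writeAck t⟩ ∈ c.net := by
  cases hs <;> try exact Or.inl h
  case writeAck hn =>
    simp only [WriterState.onAck] at h
    split_ifs at h with h1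
    · simp only [Function.update_apply] at h
      split_ifs at h with h2
      · obtain rfl := Option.some.inj h
        subst h2
        exact Or.inr (by rw [hn]; exact Multiset.mem_cons_self _ _)
      · exact Or.inl h
    · exact Or.inl h

theorem Step.mem_bcast (hs : Step byzS byzR c l d) {m : WriteMsg f V} (h : m ∈ d.bcast) :
    m ∈ c.bcast ∨ ∃ v, l = .writeInv m.ts v ∧ m.blocks = generateBlocks v m.ts := by
  cases hs <;> try exact Or.inl h
  case writeInvoke v _ _ =>
    rcases h with rfl | h
    · exact Or.inr ⟨v, rfl, rfl⟩
    · exact Or.inl h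

theorem Step.val_eq (hs : Step byzS byzR c l d) {i : Server f} {t : ℕ} {b : Block f V}
    (h : (d.servers i).val t = some b) :
    (c.servers i).val t = some b ∨
      ∃ m ∈ c.bcast, m.ts = t ∧ decrypt i (m.blocks i) = some b := by
  cases hs <;> try exact Or.inl h
  all_goals
    simp only [Function.update_apply] at h ⊢
    split_ifs at h ⊢ with hi' <;> try exact Or.inl h
    subst hi'
  · rename_i m hm hd hi
    simp only [ServerState.onWrite, Function.update_apply] at h
    split_ifs at h with h1
    · exact Or.inr ⟨m, hm, h1.symm, h⟩
    · exact Or.inl h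
  all_goals exact Or.inl h

/-- The packets that correct processes put on the network in a step from `c` to `d`. -/
inductive SentBy (c d : Config f R V) : Packet f R V → Prop
  | writeAck (i : Server f) (t : ℕ) (h : t ≤ (d.servers i).regTs) :
      SentBy c d ⟨.server i, .writer, .writeAck t⟩
  | tsResp (i : Server f) (r : R) (num : ℕ) (h : ⟨.reader r, .server i, .tsReq num⟩ ∈ c.net) :
      SentBy c d ⟨.server i, .reader r, .tsResp (c.servers i).regTs num⟩
  | valResp (i : Server f) (r : R) (t num : ℕ) (h : (r, t, num) ∈ (c.servers i).pendingVal) :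
      SentBy c d ⟨.server i, .reader r, .valResp t num⟩
  | blockResp (i : Server f) (r : R) (t num : ℕ) (h : t ≤ (c.servers i).regTs) :
      SentBy c d ⟨.server i, .reader r, .blockResp ((c.servers i).val t) t num⟩
  | auditReq (p q : Proc f R) : SentBy c d ⟨p, q, .auditReq⟩
  | auditResp (p q : Proc f R) (log : List (SignedRecord f R)) :
      SentBy c d ⟨p, q, .auditResp log⟩
  | tsReq (r : R) (q : Proc f R) (num : ℕ) (hnum : num = (d.readers r).nseq) :
      SentBy c d ⟨.reader r, q, .tsReq num⟩
  | valReq (r : R) (q : Proc f R) (t num : ℕ) (hnum : num = (d.readers r).nseq)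
      (h : NotOld (d.readers r).collectedTs t) :
      SentBy c d ⟨.reader r, q, .valReq t num⟩
  | blockReq (p q : Proc f R) (rec : SignedRecord f R) : SentBy c d ⟨p, q, .blockReq rec⟩

/-- All later invariants treat traffic through this trichotomy. Each case of `SentBy` retains only
the fact about the sender that some invariant needs, and nothing for audit traffic or `BLOCK_REQ`.
-/
theorem Step.mem_net (hs : Step byzS byzR c l d) {p : Packet f R V} (h : p ∈ d.net) :
    p ∈ c.net ∨ IsByzantine byzS byzR p.src ∨ SentBy c d p := by
  have hcons : ∀ {rest : Multiset (Packet f R V)} {q : Packet f R V},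
      c.net = q ::ₘ rest → p ∈ rest → p ∈ c.net := fun h1 h2 => by
    rw [h1]; exact Multiset.mem_cons_of_mem h2
  cases hs <;> try exact Or.inl h
  case writeAck hn => exact Or.inl (hcons hn h)
  case auditInvoke =>
    rcases Multiset.mem_add.1 h with h | h
    · obtain ⟨i, -, rfl⟩ := Multiset.mem_map.1 h
      exact Or.inr (Or.inr (.auditReq _ _))
    · exact Or.inl h
  case auditResp hn => exact Or.inl (hcons hn h)
  case deliver i m hi hm hd =>
    rcases Multiset.mem_cons.1 h with rfl | h
    · refine Or.inr (Or.inr (.writeAck _ _ ?_))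
      simpa using (regTs_le_onWrite _ _ _).2
    · exact Or.inl h
  case tsReq hn =>
    rcases Multiset.mem_cons.1 h with rfl | h
    · exact Or.inr (Or.inr (.tsResp _ _ _ (by rw [hn]; exact Multiset.mem_cons_self _ _)))
    · exact Or.inl (hcons hn h)
  case valReq hn => exact Or.inl (hcons hn h)
  case valAnswer hn ht =>
    rcases Multiset.mem_cons.1 h with rfl | h
    · exact Or.inr (Or.inr (.valResp _ _ _ _ (by rw [hn]; exact Multiset.mem_cons_self _ _)))
    · exact Or.inl h
  case blockReq hn => exact Or.inl (hcons hn h)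
  case blockAnswer hn ht =>
    rcases Multiset.mem_cons.1 h with rfl | h
    · exact Or.inr (Or.inr (.blockResp _ _ _ _ ht))
    · exact Or.inl h
  case auditReq hn =>
    rcases Multiset.mem_cons.1 h with rfl | h
    · exact Or.inr (Or.inr (.auditResp _ _ _))
    · exact Or.inl (hcons hn h)
  case readInvoke r hr hp =>
    rcases Multiset.mem_add.1 h with h | h
    · obtain ⟨i, -, rfl⟩ := Multiset.mem_map.1 h
      exact Or.inr (Or.inr (.tsReq _ _ _ (by simp [ReaderState.start])))
    · exact Or.inl h
  case tsResp r i t num rest hr hn =>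
    rcases Multiset.mem_add.1 h with h | h
    · simp only [tsRespSends] at h
      split_ifs at h with hq
      · obtain ⟨i', -, rfl⟩ := Multiset.mem_map.1 h
        have hno : NotOld ((c.readers r).onTsResp i t num).collectedTs
            (leastNotOld ((c.readers r).addTs i t).collectedTs) := by
          rw [ReaderState.onTsResp, if_pos hq]
          exact notOld_leastNotOld hq.two_mul_add_one_le
        exact Or.inr (Or.inr (.valReq _ _ _ _ (by simp [nseq_onTsResp])
          (by simpa only [Function.update_self] using hno)))
      · exact absurd h (Multiset.notMem_zero _)
    · exact Or.inl (hcons hn h)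
  case valResp hn => exact Or.inl (hcons hn h)
  case blockRequest =>
    rcases Multiset.mem_add.1 h with h | h
    · obtain ⟨i, -, rfl⟩ := Multiset.mem_map.1 h
      exact Or.inr (Or.inr (.blockReq _ _ _))
    · exact Or.inl h
  case blockResp hn => exact Or.inl (hcons hn h)
  case byzSend hp =>
    rcases Multiset.mem_cons.1 h with rfl | h
    · exact Or.inr (Or.inl hp)
    · exact Or.inl h
  case byzReceive hn => exact Or.inl (hcons hn h)

end StepLemmas

section Invariants

/-! ## Invariants of executions -/

/-- The timestamp of the operation that a step completes. -/
def Label.completedTs {f : ℕ} {R V : Type*} : Label f R V → Option ℕ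
  | .writeRes k _ => some k
  | .readRes _ _ _ k => some k
  | _ => none

/-- `v` is the initial value and `t = 0`, or a write of `v` with timestamp `t` was invoked. -/
def Authored {f : ℕ} {R V : Type*} (v₀ : V) (E : List (Label f R V)) (v : V) (t : ℕ) : Prop :=
  (t = 0 ∧ v = v₀) ∨ .writeInv t v ∈ E

/-- `b` is the `i`-th block of an authored pair with timestamp `t`. -/
def AuthenticBlock {f : ℕ} {R V : Type*} (v₀ : V) (E : List (Label f R V)) (i : Server f)
    (b : Block f V) (t : ℕ) : Prop :=
  ∃ v, b = ⟨v, t, i⟩ ∧ Authored v₀ E v t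

/-- A quorum in which every correct server has reached the timestamp `k`. -/
def Stable {f : ℕ} {R V : Type*} (byzS : Finset (Server f)) (c : Config f R V) (k : ℕ) : Prop :=
  2 * f + 1 ≤ countServers fun i => i ∉ byzS → k ≤ (c.servers i).regTs

/-- A two-element sublist encodes "occurs before"; this is how that relation grows when an execution
is extended by one step. -/
theorem pair_sublist_concat {α : Type*} {E : List α} {a b l : α} :
    List.Sublist [a, b] (E ++ [l]) ↔ List.Sublist [a, b] E ∨ (a ∈ E ∧ b = l) := by
  constructor
  · intro h
    rw [List.sublist_append_iff] at h
    obtain ⟨l₁, l₂, h, h1, h2⟩ := h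
    rcases List.sublist_singleton.1 h2 with rfl | rfl
    · left
      rw [List.append_nil] at h
      rwa [h]
    · right
      rcases l₁ with _ | ⟨x, _ | ⟨y, l₁⟩⟩
      · simp at h
      · simp only [List.cons_append, List.nil_append, List.cons.injEq, and_true] at h
        exact ⟨by simpa [h.1] using h1, h.2⟩
      · simp at h
  · rintro (h | ⟨h, rfl⟩)
    · exact h.trans (List.sublist_append_left _ _)
    · exact (List.singleton_sublist.2 h).append (List.Sublist.refl [b])

variable {f : ℕ} {R V : Type*} {v₀ : V} {byzS : Finset (Server f)} {byzR : Set R}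
  {c d : Config f R V} {E : List (Label f R V)} {l : Label f R V}

theorem Authored.append {v : V} {t : ℕ} (h : Authored v₀ E v t) : Authored v₀ (E ++ [l]) v t :=
  h.imp id fun h => List.mem_append_left _ h

theorem AuthenticBlock.append {i : Server f} {b : Block f V} {t : ℕ}
    (h : AuthenticBlock v₀ E i b t) : AuthenticBlock v₀ (E ++ [l]) i b t :=
  let ⟨v, hb, hv⟩ := h
  ⟨v, hb, hv.append⟩

/-- The fields follow a block from the broadcast through storage and transit to the reader, and an
acknowledgement from transit to the writer. Facts about received data are limited to correct
senders. `val` needs no such restriction, since stored blocks change only by deliveries of the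
writer's broadcasts. -/
structure BlocksInv (v₀ : V) (byzS : Finset (Server f)) (E : List (Label f R V))
    (c : Config f R V) : Prop where
  bcast : ∀ m ∈ c.bcast, ∃ v, .writeInv m.ts v ∈ E ∧ m.blocks = generateBlocks v m.ts
  val : ∀ i t b, (c.servers i).val t = some b → AuthenticBlock v₀ E i b t
  ackNet : ∀ i ∉ byzS, ∀ t, ⟨.server i, .writer, .writeAck t⟩ ∈ c.net → t ≤ (c.servers i).regTs
  acks : ∀ i ∉ byzS, ∀ t, c.writer.acks i = some t → t ≤ (c.servers i).regTs
  blockNet : ∀ i ∉ byzS, ∀ r b t num, ⟨.server i, .reader r, .blockResp (some b) t num⟩ ∈ c.net →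
    AuthenticBlock v₀ E i b t ∧ t ≤ (c.servers i).regTs
  collected : ∀ i ∉ byzS, ∀ r b t, (some b, t) ∈ (c.readers r).collectedBlocks i →
    AuthenticBlock v₀ E i b t ∧ t ≤ (c.servers i).regTs

/-- Correct readers have not yet used sequence numbers above the current one, and correct servers
do not answer requests that were not made. -/
structure FreshInv (byzS : Finset (Server f)) (byzR : Set R) (c : Config f R V) : Prop where
  tsReq : ∀ r ∉ byzR, ∀ q num, ⟨.reader r, q, .tsReq num⟩ ∈ c.net → num ≤ (c.readers r).nseq
  valReq : ∀ r ∉ byzR, ∀ q t num, ⟨.reader r, q, .valReq t num⟩ ∈ c.net →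
    num ≤ (c.readers r).nseq
  pendingVal : ∀ r ∉ byzR, ∀ i t num, (r, t, num) ∈ (c.servers i).pendingVal →
    num ≤ (c.readers r).nseq
  tsResp : ∀ r ∉ byzR, ∀ i ∉ byzS, ∀ t num, ⟨.server i, .reader r, .tsResp t num⟩ ∈ c.net →
    num ≤ (c.readers r).nseq
  valResp : ∀ r ∉ byzR, ∀ i ∉ byzS, ∀ t num, ⟨.server i, .reader r, .valResp t num⟩ ∈ c.net →
    num ≤ (c.readers r).nseq

/-- During the `n`-th read of `r`, the timestamps received from correct servers of the quorum `Q`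
are at least `k`. -/
structure ReadBound (byzS : Finset (Server f)) (k : ℕ) (Q : Server f → Prop) (r : R) (n : ℕ)
    (c : Config f R V) : Prop where
  nseq : n ≤ (c.readers r).nseq
  regTs : ∀ i ∉ byzS, Q i → k ≤ (c.servers i).regTs
  tsResp : ∀ i ∉ byzS, Q i → ∀ t, ⟨.server i, .reader r, .tsResp t n⟩ ∈ c.net → k ≤ t
  valReq : ∀ q t, ⟨.reader r, q, .valReq t n⟩ ∈ c.net → k ≤ t
  pendingVal : ∀ i t, (r, t, n) ∈ (c.servers i).pendingVal → k ≤ t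
  valResp : ∀ i ∉ byzS, ∀ t, ⟨.server i, .reader r, .valResp t n⟩ ∈ c.net → k ≤ t
  collectedTs : (c.readers r).nseq = n → ∀ i ∉ byzS, Q i → ∀ t ∈ (c.readers r).collectedTs i,
    k ≤ t

/-- Links the local counters and phases to the trace, so that operation identifiers are never reused
and an operation cannot respond twice. -/
structure ControlInv (E : List (Label f R V)) (c : Config f R V) : Prop where
  writeInv : ∀ k v, .writeInv k v ∈ E → 1 ≤ k ∧ k ≤ c.writer.ts
  writing : ∀ v, c.writer.phase = .writing v →
    .writeInv c.writer.ts v ∈ E ∧ ∀ v', .writeRes c.writer.ts v' ∉ E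
  writeRes : ∀ k v, .writeRes k v ∈ E → .writeInv k v ∈ E
  readInv : ∀ r n, .readInv r n ∈ E → n ≤ (c.readers r).nseq
  reading : ∀ r, (c.readers r).phase ≠ .idle →
    .readInv r (c.readers r).nseq ∈ E ∧ ∀ v t, .readRes r (c.readers r).nseq v t ∉ E
  readRes : ∀ r n v t, .readRes r n v t ∈ E → .readInv r n ∈ E

/-- The `2f+1` servers that witness `NotOld` meet `Q` in a correct server, whose collected timestamp
lies between `k` and `t`. -/
theorem NotOld.ge_of_readBound {k t : ℕ} {Q : Server f → Prop} {r : R}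
    (hbyz : byzS.card ≤ f) (hQ : 2 * f + 1 ≤ countServers Q)
    (hc : ∀ i ∉ byzS, Q i → ∀ t ∈ (c.readers r).collectedTs i, k ≤ t)
    (h : NotOld (c.readers r).collectedTs t) : k ≤ t := by
  obtain ⟨i, hi, hq, t', ht', hle⟩ := exists_correct_of_quorums hbyz hQ h
  exact (hc i hi hq t' ht').trans hle

variable [DecidableEq R]

theorem Stable.step {k : ℕ} (h : Stable byzS c k) (hs : Step byzS byzR c l d) :
    Stable byzS d k :=
  h.trans (countServers_mono fun i hi hb => (hi hb).trans (hs.regTs_mono i))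

theorem BlocksInv.step (h : BlocksInv v₀ byzS E c) (hs : Step byzS byzR c l d) :
    BlocksInv v₀ byzS (E ++ [l]) d where
  bcast m hm := by
    rcases hs.mem_bcast hm with hm | ⟨v, rfl, hb⟩
    · obtain ⟨v, h1, h2⟩ := h.bcast m hm
      exact ⟨v, List.mem_append_left _ h1, h2⟩
    · exact ⟨v, by simp, hb⟩
  val i t b hb := by
    rcases hs.val_eq hb with hb | ⟨m, hm, rfl, hb'⟩
    · exact (h.val i t b hb).append
    · obtain ⟨v, h1, h2⟩ := h.bcast m hm
      rw [h2] at hb'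
      simp only [decrypt, generateBlocks, if_true, Option.some.injEq] at hb'
      exact ⟨v, hb'.symm, Or.inr (List.mem_append_left _ h1)⟩
  ackNet i hi t hp := by
    rcases hs.mem_net hp with hp | hp | hp
    · exact (h.ackNet i hi t hp).trans (hs.regTs_mono i)
    · exact absurd hp hi
    · cases hp
      assumption
  acks i hi t hp := by
    rcases hs.acks_eq hp with hp | hp
    · exact (h.acks i hi t hp).trans (hs.regTs_mono i)
    · exact (h.ackNet i hi t hp).trans (hs.regTs_mono i)
  blockNet i hi r b t num hp := by
    rcases hs.mem_net hp with hp | hp | hp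
    · obtain ⟨h1, h2⟩ := h.blockNet i hi r b t num hp
      exact ⟨h1.append, h2.trans (hs.regTs_mono i)⟩
    · exact absurd hp hi
    · generalize hb : some b = b' at hp
      cases hp with
      | blockResp _ _ _ _ ht =>
        exact ⟨(h.val i t b hb.symm).append, ht.trans (hs.regTs_mono i)⟩
  collected i hi r b t hp := by
    rcases hs.mem_collectedBlocks hp with hp | ⟨num, hp⟩
    · obtain ⟨h1, h2⟩ := h.collected i hi r b t hp
      exact ⟨h1.append, h2.trans (hs.regTs_mono i)⟩
    · obtain ⟨h1, h2⟩ := h.blockNet i hi r b t num hp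
      exact ⟨h1.append, h2.trans (hs.regTs_mono i)⟩

theorem FreshInv.step (h : FreshInv byzS byzR c) (hs : Step byzS byzR c l d) :
    FreshInv byzS byzR d where
  tsReq r hr q num hp := by
    rcases hs.mem_net hp with hp | hp | hp
    · exact (h.tsReq r hr q num hp).trans (hs.nseq_mono r)
    · exact absurd hp hr
    · cases hp with
      | tsReq _ _ _ hnum => exact hnum.le
  valReq r hr q t num hp := by
    rcases hs.mem_net hp with hp | hp | hp
    · exact (h.valReq r hr q t num hp).trans (hs.nseq_mono r)
    · exact absurd hp hr
    · cases hp with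
      | valReq _ _ _ _ hnum => exact hnum.le
  pendingVal r hr i t num hp := by
    rcases hs.mem_pendingVal hp with hp | hp
    · exact (h.pendingVal r hr i t num hp).trans (hs.nseq_mono r)
    · exact (h.valReq r hr _ t num hp).trans (hs.nseq_mono r)
  tsResp r hr i hi t num hp := by
    rcases hs.mem_net hp with hp | hp | hp
    · exact (h.tsResp r hr i hi t num hp).trans (hs.nseq_mono r)
    · exact absurd hp hi
    · cases hp with
      | tsResp _ _ _ hp => exact (h.tsReq r hr _ num hp).trans (hs.nseq_mono r)
  valResp r hr i hi t num hp := by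
    rcases hs.mem_net hp with hp | hp | hp
    · exact (h.valResp r hr i hi t num hp).trans (hs.nseq_mono r)
    · exact absurd hp hi
    · cases hp with
      | valResp _ _ _ _ hp => exact (h.pendingVal r hr _ t num hp).trans (hs.nseq_mono r)

/-- The bound travels around the loop of collected timestamps, `VAL_REQ`, pending request,
`VAL_RESP` and back. Each arrow costs a step, except that receiving a timestamp and sending the
`VAL_REQ` computed from it happen in the same step. -/
theorem ReadBound.step {k n : ℕ} {Q : Server f → Prop} {r : R} (hbyz : byzS.card ≤ f)
    (hQ : 2 * f + 1 ≤ countServers Q) (hr : r ∉ byzR)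
    (h : ReadBound byzS k Q r n c) (hs : Step byzS byzR c l d) : ReadBound byzS k Q r n d := by
  -- Proved first because a `VAL_REQ` sent in this step is computed from the sets of `d`, while
  -- these depend only on the sets and packets of `c`.
  have hcoll : (d.readers r).nseq = n → ∀ i ∉ byzS, Q i →
      ∀ t ∈ (d.readers r).collectedTs i, k ≤ t := by
    intro hn i hi hq t ht
    obtain ⟨h1, h2⟩ := hs.mem_collectedTs ht
    rw [h1] at hn
    subst hn
    rcases h2 with h2 | h2 | h2
    · exact h.collectedTs rfl i hi hq t h2
    · exact h.tsResp i hi hq t h2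
    · exact h.valResp i hi t h2
  refine ⟨h.nseq.trans (hs.nseq_mono r), fun i hi hq => (h.regTs i hi hq).trans (hs.regTs_mono i),
    fun i hi hq t hp => ?_, fun q t hp => ?_, fun i t hp => ?_, fun i hi t hp => ?_, hcoll⟩
  · rcases hs.mem_net hp with hp | hp | hp
    · exact h.tsResp i hi hq t hp
    · exact absurd hp hi
    · cases hp
      exact h.regTs i hi hq
  · rcases hs.mem_net hp with hp | hp | hp
    · exact h.valReq q t hp
    · exact absurd hp hr
    · cases hp with
      | valReq _ _ _ _ hnum hno =>
        exact hno.ge_of_readBound hbyz hQ (hcoll hnum.symm)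
  · rcases hs.mem_pendingVal hp with hp | hp
    · exact h.pendingVal i t hp
    · exact h.valReq _ t hp
  · rcases hs.mem_net hp with hp | hp | hp
    · exact h.valResp i hi t hp
    · exact absurd hp hi
    · cases hp with
      | valResp _ _ _ _ hp => exact h.pendingVal _ t hp

/-- At the start of a read its sequence number is new, so no answer to it and no `VAL_REQ` carrying
it exists, and the bounds on messages and collected timestamps hold vacuously. Byzantine servers
belong to this `Q` trivially; thus `Stable` says exactly that it is a quorum. -/
theorem FreshInv.readBound {k n : ℕ} {r : R} (h : FreshInv byzS byzR c)
    (hs : Step byzS byzR c (.readInv r n) d) :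
    ReadBound byzS k (fun i => i ∉ byzS → k ≤ (c.servers i).regTs) r n d := by
  cases hs with
  | readInvoke _ hr hp =>
    -- The step adds only `TS_REQ` packets, so every other packet was in transit before.
    have hnet : ∀ p : Packet f R V, (∀ num, p.msg ≠ .tsReq num) →
        p ∈ toAll (.reader r) (.tsReq ((c.readers r).nseq + 1)) + c.net → p ∈ c.net := by
      intro p hp h
      rcases Multiset.mem_add.1 h with h | h
      · obtain ⟨i, -, rfl⟩ := Multiset.mem_map.1 h
        exact absurd rfl (hp _)
      · exact h
    refine ⟨?_, fun i hi hq => hq hi, fun i hi hq t hp => ?_, fun q t hp => ?_, fun i t hp => ?_,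
      fun i hi t hp => ?_, ?_⟩
    · simp [ReaderState.start]
    · have := h.tsResp r hr i hi t _ (hnet _ (by simp) hp)
      omega
    · have := h.valReq r hr q t _ (hnet _ (by simp) hp)
      omega
    · have := h.pendingVal r hr i t _ hp
      omega
    · have := h.valResp r hr i hi t _ (hnet _ (by simp) hp)
      omega
    · simp [ReaderState.start]

/-- Silent steps may start or end an audit, or move a reader from collecting to fetching, so phases
are compared only through `writing` and non-idleness. -/
theorem Step.control_of_event_eq_none (hs : Step byzS byzR c l d) (hl : l.event = none) :
    d.writer.ts = c.writer.ts ∧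
    (∀ v, d.writer.phase = .writing v → c.writer.phase = .writing v) ∧
    ∀ r, (d.readers r).nseq = (c.readers r).nseq ∧
      ((d.readers r).phase ≠ .idle → (c.readers r).phase ≠ .idle) := by
  cases hs <;> try first
    | exact ⟨rfl, fun _ h => h, fun _ => ⟨rfl, fun h => h⟩⟩
    | exact ⟨rfl, fun _ h => (nomatch h), fun _ => ⟨rfl, fun h => h⟩⟩
    | cases hl
  case writeAck => exact ⟨(ts_onAck _ _ _).1, fun v h => (ts_onAck _ _ _).2 ▸ h,
      fun _ => ⟨rfl, fun h => h⟩⟩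
  all_goals
    refine ⟨rfl, fun _ h => h, fun r => ?_⟩
    simp only [Function.update_apply]
    split_ifs with h
    · subst h
      simp_all [nseq_onTsResp, nseq_onValResp, nseq_onBlockResp]
    · exact ⟨rfl, fun h => h⟩

theorem ControlInv.step (h : ControlInv E c) (hs : Step byzS byzR c l d) :
    ControlInv (E ++ [l]) d := by
  by_cases hl : l.event = none
  · obtain ⟨h1, h2, h3⟩ := hs.control_of_event_eq_none hl
    have hE : ∀ l' : Label f R V, l' ∈ E ++ [l] → l'.event ≠ none → l' ∈ E := by
      intro l' hl' hne
      rcases List.mem_append.1 hl' with hl' | hl'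
      · exact hl'
      · rw [List.mem_singleton.1 hl'] at hne
        exact absurd hl hne
    constructor
    · intro k v hk
      rw [h1]
      exact h.writeInv k v (hE _ hk (by simp [Label.event]))
    · intro v hv
      rw [h1]
      obtain ⟨h4, h5⟩ := h.writing v (h2 v hv)
      exact ⟨List.mem_append_left _ h4, fun v' hv' => h5 v' (hE _ hv' (by simp [Label.event]))⟩
    · intro k v hk
      exact List.mem_append_left _ (h.writeRes k v (hE _ hk (by simp [Label.event])))
    · intro r n hn
      rw [(h3 r).1]
      exact h.readInv r n (hE _ hn (by simp [Label.event]))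
    · intro r hp
      rw [(h3 r).1]
      obtain ⟨h4, h5⟩ := h.reading r ((h3 r).2 hp)
      exact ⟨List.mem_append_left _ h4,
        fun v t hv => h5 v t (hE _ hv (by simp [Label.event]))⟩
    · intro r n v t hv
      exact List.mem_append_left _ (h.readRes r n v t (hE _ hv (by simp [Label.event])))
  · cases l <;> try exact absurd rfl hl
    case writeInv k v =>
      cases hs with
      | writeInvoke _ hc hp =>
      constructor
      · intro k v hk
        simp only [List.mem_append, List.mem_singleton, Label.writeInv.injEq] at hk
        rcases hk with hk | ⟨rfl, -⟩
        · have := h.writeInv k v hk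
          simp only
          omega
        · simp
      · intro v' hv'
        simp only [WriterPhase.writing.injEq] at hv'
        subst hv'
        refine ⟨by simp, fun v' hv' => ?_⟩
        -- A response with the new timestamp would require an earlier invocation with a timestamp
        -- above the writer's old counter.
        simp only [List.mem_append, List.mem_singleton, reduceCtorEq, or_false] at hv'
        have := (h.writeInv _ _ (h.writeRes _ _ hv')).2
        omega
      · intro k v hk
        simp only [List.mem_append, List.mem_singleton, reduceCtorEq, or_false] at hk
        exact List.mem_append_left _ (h.writeRes k v hk)
      · simpa using h.readInv
      · simpa using h.reading
      · simpa using h.readRes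
    case writeRes k v =>
      cases hs with
      | writeReturn _ hc hp hq =>
      constructor
      · simpa using h.writeInv
      · simp
      · intro k v' hk
        simp only [List.mem_append, List.mem_singleton, Label.writeRes.injEq] at hk
        rcases hk with hk | ⟨rfl, rfl⟩
        · exact List.mem_append_left _ (h.writeRes k v' hk)
        · exact List.mem_append_left _ (h.writing _ hp).1
      · simpa using h.readInv
      · simpa using h.reading
      · simpa using h.readRes
    case readInv r n =>
      cases hs with
      | readInvoke _ hr hp =>
      constructor
      · simpa using h.writeInv
      · simpa using h.writing
      · simpa using h.writeRes
      · intro r' n hn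
        simp only [List.mem_append, List.mem_singleton, Label.readInv.injEq] at hn
        simp only [Function.update_apply]
        rcases hn with hn | ⟨rfl, rfl⟩
        · have := h.readInv r' n hn
          split_ifs with hr'
          · subst hr'
            simp only [ReaderState.start]
            omega
          · exact this
        · simp [ReaderState.start]
      · intro r' hr'
        simp only [Function.update_apply] at hr' ⊢
        split_ifs at hr' ⊢ with hr''
        · subst hr''
          simp only [ReaderState.start, List.mem_append, List.mem_singleton, or_true, true_and,
            reduceCtorEq, or_false]
          intro v t hv
          have := h.readInv _ _ (h.readRes _ _ _ _ hv)
          omega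
        · simpa [hr''] using h.reading r' hr'
      · intro r' n v t hv
        simp only [List.mem_append, List.mem_singleton, reduceCtorEq, or_false] at hv
        exact List.mem_append_left _ (h.readRes r' n v t hv)
    case readRes r n v t =>
      cases hs with
      | readReturn _ _ _ hr hp hv ho =>
      have hp' : (c.readers r).phase ≠ .idle := by simp [hp]
      constructor
      · simpa using h.writeInv
      · simpa using h.writing
      · simpa using h.writeRes
      · intro r' n hn
        simp only [List.mem_append, List.mem_singleton, reduceCtorEq, or_false] at hn
        have := h.readInv r' n hn
        simp only [Function.update_apply]
        split_ifs with hr'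
        · subst hr'
          exact this
        · exact this
      · intro r' hr'
        simp only [Function.update_apply] at hr' ⊢
        split_ifs at hr' ⊢ with hr''
        · simp at hr'
        · simpa [hr''] using h.reading r' hr'
      · intro r' n v' t' hv
        simp only [List.mem_append, List.mem_singleton, Label.readRes.injEq] at hv
        rcases hv with hv | ⟨rfl, rfl, -, -⟩
        · exact List.mem_append_left _ (h.readRes r' n v' t' hv)
        · exact List.mem_append_left _ (h.reading _ hp').1

end Invariants

section Traces

/-! ## Properties of the traces of executions -/

variable {f : ℕ} {R V : Type*} {v₀ : V} {byzS : Finset (Server f)} {byzR : Set R}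
  {c d : Config f R V} {E : List (Label f R V)} {l : Label f R V}

/-- The order and values of the operations in an execution. -/
structure TraceInv (v₀ : V) (E : List (Label f R V)) : Prop where
  once : (history E).Pairwise fun a b => a.op = b.op → ∃ o x, a = .inv o ∧ b = .res o x
  one_le : ∀ k v, .writeInv k v ∈ E → 1 ≤ k
  writeRes : ∀ k v, .writeRes k v ∈ E → .writeInv k v ∈ E
  readRes : ∀ r n v t, .readRes r n v t ∈ E → .readInv r n ∈ E
  authored : ∀ r n v t, .readRes r n v t ∈ E → Authored v₀ E v t
  writes : E.Pairwise fun l₁ l₂ => ∀ k k' v',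
    (l₁.completedTs = some k ∨ ∃ v, l₁ = .writeInv k v) → l₂ = .writeInv k' v' → k < k'
  reads : ∀ l k r n v t, l.completedTs = some k → List.Sublist [l, .readInv r n] E →
    .readRes r n v t ∈ E → k ≤ t ∧ List.Sublist [l, .readRes r n v t] E

/-- The inductive invariant of the whole system. Only `trace`, which does not mention
configurations, is used once the induction over steps is finished. -/
structure SystemInv (v₀ : V) (byzS : Finset (Server f)) (byzR : Set R) (E : List (Label f R V))
    (c : Config f R V) : Prop where
  blocks : BlocksInv v₀ byzS E c
  fresh : FreshInv byzS byzR c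
  control : ControlInv E c
  stable : ∀ l ∈ E, ∀ k, l.completedTs = some k → Stable byzS c k
  bound : ∀ r ∉ byzR, ∀ l k n, l.completedTs = some k → List.Sublist [l, .readInv r n] E →
    ∃ Q, 2 * f + 1 ≤ countServers Q ∧ ReadBound byzS k Q r n c
  trace : TraceInv v₀ E

theorem mem_history {e : HEvent R V} : e ∈ history E ↔ ∃ l ∈ E, l.event = some e :=
  List.mem_filterMap

theorem inv_write_mem_history {k : ℕ} {v : V} :
    HEvent.inv (.write k v) ∈ history E ↔ .writeInv k v ∈ E := by
  rw [mem_history]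
  constructor
  · rintro ⟨l, hl, h⟩
    cases l <;> simp_all [Label.event]
  · exact fun h => ⟨_, h, rfl⟩

theorem res_write_mem_history {k : ℕ} {v : V} {x : Ret V} :
    HEvent.res (.write k v) x ∈ history E ↔ x = .ack ∧ .writeRes k v ∈ E := by
  rw [mem_history]
  constructor
  · rintro ⟨l, hl, h⟩
    cases l <;> simp_all [Label.event]
  · rintro ⟨rfl, h⟩
    exact ⟨_, h, rfl⟩

theorem inv_read_mem_history {r : R} {n : ℕ} :
    HEvent.inv (.read r n) ∈ history E ↔ .readInv r n ∈ E := by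
  rw [mem_history]
  constructor
  · rintro ⟨l, hl, h⟩
    cases l <;> simp_all [Label.event]
  · exact fun h => ⟨_, h, rfl⟩

theorem res_read_mem_history {r : R} {n : ℕ} {x : Ret V} :
    HEvent.res (.read r n) x ∈ history E ↔ ∃ v t, x = .value v ∧ .readRes r n v t ∈ E := by
  rw [mem_history]
  constructor
  · rintro ⟨l, hl, h⟩
    cases l <;> simp_all [Label.event]
    case readRes v t => exact ⟨v, h.2.symm, t, hl⟩
  · rintro ⟨v, t, rfl, h⟩
    exact ⟨_, h, rfl⟩

theorem history_append {E' : List (Label f R V)} :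
    history (E ++ E') = history E ++ history E' :=
  List.filterMap_append

theorem BlocksInv.of_decodable {t : ℕ} {v : V} {r : R} (h : BlocksInv v₀ byzS E c)
    (hbyz : byzS.card ≤ f) (hd : Decodable (c.readers r).collectedBlocks v t) :
    Authored v₀ E v t ∧ Stable byzS c t := by
  constructor
  · obtain ⟨i, hi, hb, -⟩ := exists_correct_of_quorums hbyz hd hd
    obtain ⟨v', hv', ha⟩ := (h.collected i hi r _ t hb).1
    rw [Block.mk.injEq] at hv'
    rw [hv'.1]
    exact ha
  · exact hd.trans (countServers_mono fun i hb hi => (h.collected i hi r _ t hb).2)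

theorem ControlInv.authored_le {v : V} {t : ℕ} (h : ControlInv E c) (ha : Authored v₀ E v t) :
    t ≤ c.writer.ts := by
  rcases ha with ⟨rfl, -⟩ | ha
  · exact Nat.zero_le _
  · exact (h.writeInv t v ha).2

theorem ControlInv.completedTs_le {k : ℕ} (h : ControlInv E c) (ht : TraceInv v₀ E)
    (hl : l ∈ E) (hk : l.completedTs = some k ∨ ∃ v, l = .writeInv k v) : k ≤ c.writer.ts := by
  rcases hk with hk | ⟨v, rfl⟩
  · cases l <;> try cases hk
    · exact (h.writeInv _ _ (h.writeRes _ _ hl)).2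
    · exact h.authored_le (ht.authored _ _ _ _ hl)
  · exact (h.writeInv _ _ hl).2

theorem SystemInv.start : SystemInv v₀ byzS byzR [] (Config.initial f R v₀) where
  blocks := by
    constructor
    · simp [Config.initial]
    · intro i t b h
      simp only [Config.initial] at h
      split_ifs at h with ht
      · subst ht
        exact ⟨v₀, (Option.some.inj h).symm, Or.inl ⟨rfl, rfl⟩⟩
    all_goals simp [Config.initial]
  fresh := by constructor <;> simp [Config.initial]
  control := by constructor <;> simp [Config.initial]
  stable := by simp
  bound := by simp
  trace := by constructor <;> simp [history]

variable [DecidableEq R]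

theorem Step.once (hs : Step byzS byzR c l d) (hc : ControlInv E c) {a b : HEvent R V}
    (ha : a ∈ history E) (hb : l.event = some b) (hab : a.op = b.op) :
    ∃ o x, a = .inv o ∧ b = .res o x := by
  cases l <;> try cases hb
  case writeInv k v =>
    cases hs
    have hw : .writeInv (c.writer.ts + 1) v ∈ E := by
      cases a with
      | inv o =>
        cases hab
        exact inv_write_mem_history.1 ha
      | res o x =>
        cases hab
        exact hc.writeRes _ _ (res_write_mem_history.1 ha).2
    have := (hc.writeInv _ _ hw).2
    omega
  case writeRes k v =>
    cases hs with
    | writeReturn _ h1 hp =>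
    cases a with
    | inv o =>
      cases hab
      exact ⟨_, _, rfl, rfl⟩
    | res o x =>
      cases hab
      exact absurd (res_write_mem_history.1 ha).2 ((hc.writing _ hp).2 _)
  case readInv r n =>
    cases hs
    have hw : .readInv r ((c.readers r).nseq + 1) ∈ E := by
      cases a with
      | inv o =>
        cases hab
        exact inv_read_mem_history.1 ha
      | res o x =>
        cases hab
        obtain ⟨_, _, -, h⟩ := res_read_mem_history.1 ha
        exact hc.readRes _ _ _ _ h
    have := hc.readInv _ _ hw
    omega
  case readRes r n v t =>
    cases hs with
    | readReturn _ _ _ h1 hp =>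
    cases a with
    | inv o =>
      cases hab
      exact ⟨_, _, rfl, rfl⟩
    | res o x =>
      cases hab
      obtain ⟨_, _, -, h⟩ := res_read_mem_history.1 ha
      exact absurd h ((hc.reading r (by rw [hp]; simp)).2 _ _)

theorem SystemInv.step (hbyz : byzS.card ≤ f) (h : SystemInv v₀ byzS byzR E c)
    (hs : Step byzS byzR c l d) : SystemInv v₀ byzS byzR (E ++ [l]) d := by
  have hcontrol := h.control.step hs
  have hret : ∀ r n v t, l = .readRes r n v t → r ∉ byzR ∧ n = (c.readers r).nseq ∧
      Decodable (c.readers r).collectedBlocks v t ∧ NotOld (c.readers r).collectedTs t := by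
    rintro r n v t rfl
    cases hs with
    | readReturn _ _ _ hr hp hv ho => exact ⟨hr, rfl, hv.1, ho⟩
  refine ⟨h.blocks.step hs, h.fresh.step hs, hcontrol, ?_, ?_, ?_⟩
  · intro l' hl' k hk
    rcases List.mem_append.1 hl' with hl' | hl'
    · exact (h.stable l' hl' k hk).step hs
    · rw [List.mem_singleton.1 hl'] at hk
      refine Stable.step ?_ hs
      cases l <;> try cases hk
      · cases hs with
        | writeReturn _ hc hp hq =>
          refine le_trans ?_ (hq.trans (countServers_mono fun i hb hi => h.blocks.acks i hi _ hb))
          unfold numServers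
          omega
      · exact (h.blocks.of_decodable hbyz (hret _ _ _ _ rfl).2.2.1).2
  · intro r hr l' k n hk hsub
    rcases pair_sublist_concat.1 hsub with hsub | ⟨hl', rfl⟩
    · obtain ⟨Q, hQ, hb⟩ := h.bound r hr l' k n hk hsub
      exact ⟨Q, hQ, hb.step hbyz hQ hr hs⟩
    -- The read starts in this step; the quorum left behind by the earlier operation becomes its
    -- `Q`.
    · exact ⟨_, h.stable l' hl' k hk, h.fresh.readBound hs⟩
  · constructor
    · rw [history_append, List.pairwise_append]
      refine ⟨h.trace.once, ?_, ?_⟩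
      · cases hl : l.event <;> simp [history, hl]
      · intro a ha b hb hab
        obtain ⟨l', hl', hb⟩ := mem_history.1 hb
        rw [List.mem_singleton.1 hl'] at hb
        exact hs.once h.control ha hb hab
    · exact fun k v hk => (hcontrol.writeInv k v hk).1
    · exact hcontrol.writeRes
    · exact hcontrol.readRes
    · intro r n v t hv
      rcases List.mem_append.1 hv with hv | hv
      · exact (h.trace.authored r n v t hv).append
      · exact (h.blocks.of_decodable hbyz (hret r n v t (List.mem_singleton.1 hv).symm).2.2.1).1.append
    · rw [List.pairwise_append]
      refine ⟨h.trace.writes, List.pairwise_singleton _ _, ?_⟩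
      intro l₁ hl₁ l₂ hl₂ k k' v' hk hk'
      rw [List.mem_singleton.1 hl₂] at hk'
      subst hk'
      cases hs
      -- A new write takes the counter plus one, and all earlier timestamps, including those of
      -- reads because they are authored, are at most the counter.
      exact Nat.lt_succ_of_le (h.control.completedTs_le h.trace hl₁ hk)
    · intro l' k r n v t hk hsub hv
      rcases List.mem_append.1 hv with hv' | hv'
      · rcases pair_sublist_concat.1 hsub with hsub | ⟨hl', rfl⟩
        · obtain ⟨h1, h2⟩ := h.trace.reads l' k r n v t hk hsub hv'
          exact ⟨h1, h2.trans (List.sublist_append_left _ _)⟩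
        -- A read that starts now has a sequence number never used before, so it cannot already have
        -- returned.
        · cases hs
          have := h.control.readInv _ _ (h.control.readRes _ _ _ _ hv')
          omega
      · have hl := List.mem_singleton.1 hv'
        obtain ⟨hr, hn, -, ho⟩ := hret r n v t hl.symm
        subst hl
        rcases pair_sublist_concat.1 hsub with hsub | ⟨-, hl⟩
        · obtain ⟨Q, hQ, hb⟩ := h.bound r hr l' k n hk hsub
          exact ⟨ho.ge_of_readBound hbyz hQ (hb.collectedTs hn.symm),
            pair_sublist_concat.2 (Or.inr ⟨hsub.subset (by simp), rfl⟩)⟩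
        · cases hl

theorem Run.systemInv (hbyz : byzS.card ≤ f) (h : Run v₀ byzS byzR E c) :
    SystemInv v₀ byzS byzR E c := by
  induction h with
  | start => exact SystemInv.start
  | step E c d l h hs ih => exact ih.step hbyz hs

end Traces

/-! ## Insertion of reads into a sequence of writes -/

section Insertion

variable {R V : Type*}

/-- The timestamp of an operation, where `τ r n` is the timestamp of the `n`-th read of `r`. -/
def opTs (τ : R → ℕ → ℕ) : Op R V → ℕ
  | .write k _ => k
  | .read r n => τ r n

/-- Timestamps increase from `a` to `b`, strictly if `b` is a write. -/
def TsOrdered (τ : R → ℕ → ℕ) (a b : Op R V × Ret V) : Prop :=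
  opTs τ a.1 ≤ opTs τ b.1 ∧ ∀ k v, b.1 = .write k v → opTs τ a.1 < k

/-- Insertion compares timestamps with writes only, so without further assumptions nothing is known
about the reads in `A`. -/
theorem exists_insertRead_eq (rd : Op R V × Ret V) (ts : ℕ) (L : List (Op R V × Ret V)) :
    ∃ A B, L = A ++ B ∧ insertRead rd ts L = A ++ rd :: B ∧
      (∀ k v x, (.write k v, x) ∈ A → k ≤ ts) ∧
      ∀ b ∈ B.head?, ∃ k v, b.1 = .write k v ∧ ts < k := by
  induction L with
  | nil => exact ⟨[], [], rfl, rfl, by simp, by simp⟩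
  | cons a L ih =>
    obtain ⟨A, B, hL, hins, hA, hB⟩ := ih
    obtain ⟨o, x⟩ := a
    cases o with
    | write k v =>
      by_cases hk : ts < k
      · exact ⟨[], _, rfl, by simp [insertRead, hk], by simp, by simp [hk]⟩
      · refine ⟨(.write k v, x) :: A, B, by simp [hL], by simp [insertRead, hk, hins], ?_, hB⟩
        intro k' v' x' h
        rcases List.mem_cons.1 h with h | h
        · cases h
          exact not_lt.1 hk
        · exact hA k' v' x' h
    | read r n =>
      refine ⟨(.read r n, x) :: A, B, by simp [hL], by simp [insertRead, hins], ?_, hB⟩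
      intro k' v' x' h
      rcases List.mem_cons.1 h with h | h
      · cases h
      · exact hA k' v' x' h

/-- A read in the prefix has timestamp `0` or comes after the write of its timestamp; that write is
then in the prefix too and bounds it. This is why `hreads` is required. -/
theorem exists_insertRead_eq_of_ordered {τ : R → ℕ → ℕ} {L : List (Op R V × Ret V)}
    (hL : L.Pairwise (TsOrdered τ))
    (hreads : ∀ r n x, (.read r n, x) ∈ L → τ r n = 0 ∨ ∃ v y, (.write (τ r n) v, y) ∈ L)
    (rd : Op R V × Ret V) (ts : ℕ) :
    ∃ A B, L = A ++ B ∧ insertRead rd ts L = A ++ rd :: B ∧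
      (∀ a ∈ A, opTs τ a.1 ≤ ts) ∧ ∀ b ∈ B, ts < opTs τ b.1 := by
  obtain ⟨A, B, rfl, hins, hA, hB⟩ := exists_insertRead_eq rd ts L
  obtain ⟨-, hordB, hAB⟩ := List.pairwise_append.1 hL
  have hB' : ∀ b ∈ B, ts < opTs τ b.1 := by
    cases B with
    | nil => simp
    | cons w B =>
      obtain ⟨k, v, hw, hk⟩ := hB w rfl
      intro b hb
      rcases List.mem_cons.1 hb with rfl | hb
      · rw [hw]
        exact hk
      · have := ((List.pairwise_cons.1 hordB).1 b hb).1
        rw [hw] at this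
        exact hk.trans_le this
  refine ⟨A, B, rfl, hins, ?_, hB'⟩
  rintro ⟨o, x⟩ ha
  cases o with
  | write k v => exact hA k v x ha
  | read r n =>
    rcases hreads r n x (List.mem_append_left _ ha) with h0 | ⟨v, y, hw⟩
    · exact h0.trans_le (Nat.zero_le _)
    · rcases List.mem_append.1 hw with hw | hw
      · exact hA _ v y hw
      · exact absurd ((hAB _ ha _ hw).2 _ _ rfl) (lt_irrefl _)

/-- `L` arises from the writes `W` by inserting the reads `S`. -/
structure IsMerge (τ : R → ℕ → ℕ) (W : List (Op R V × Ret V))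
    (S : List ((Op R V × Ret V) × ℕ)) (L : List (Op R V × Ret V)) : Prop where
  perm : L.Perm (S.map Prod.fst ++ W)
  writes : L.filterMap writeTimestamp = W.filterMap writeTimestamp
  ordered : L.Pairwise (TsOrdered τ)
  reads : ∀ a b, List.Sublist [a, b] S → a.2 ≤ b.2 → List.Sublist [a.1, b.1] L

/-- Each new read is placed after every operation of timestamp at most its own and before all larger
ones. Order is preserved, and an earlier inserted read with a timestamp no larger stays in front of
it. -/
theorem isMerge_foldl_insertRead {τ : R → ℕ → ℕ} {W : List (Op R V × Ret V)}
    {S : List ((Op R V × Ret V) × ℕ)} (hW : ∀ w ∈ W, ∃ k v, w = (.write k v, .ack))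
    (hlt : (W.filterMap writeTimestamp).Pairwise (· < ·))
    (hS : ∀ s ∈ S, ∃ r n v, s = ((.read r n, .value v), τ r n) ∧
      (τ r n = 0 ∨ ∃ v', (.write (τ r n) v', .ack) ∈ W)) :
    IsMerge τ W S (S.foldl (fun l rd => insertRead rd.1 rd.2 l) W) := by
  induction S using List.reverseRecOn with
  | nil =>
    refine ⟨by simp, rfl, ?_, by simp⟩
    rw [List.pairwise_filterMap] at hlt
    refine hlt.imp_of_mem fun {a b} ha hb h => ?_
    obtain ⟨k, v, rfl⟩ := hW a ha
    obtain ⟨k', v', rfl⟩ := hW b hb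
    have hk := h k rfl k' rfl
    refine ⟨hk.le, ?_⟩
    rintro _ _ ⟨⟩
    exact hk
  | append_singleton S s ih =>
    have hm := ih fun s hs => hS s (List.mem_append_left _ hs)
    rw [List.foldl_append, List.foldl_cons, List.foldl_nil]
    generalize List.foldl (fun l rd => insertRead rd.1 rd.2 l) W S = L at hm ⊢
    have hreads : ∀ r n x, (.read r n, x) ∈ L →
        τ r n = 0 ∨ ∃ v y, (.write (τ r n) v, y) ∈ L := by
      intro r n x h
      rcases List.mem_append.1 (hm.perm.mem_iff.1 h) with h | h
      · obtain ⟨s', hs', h⟩ := List.mem_map.1 h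
        obtain ⟨r', n', v, rfl, h'⟩ := hS s' (List.mem_append_left _ hs')
        cases h
        refine h'.imp id fun ⟨v', h'⟩ => ⟨v', _, hm.perm.mem_iff.2 (List.mem_append_right _ h')⟩
      · obtain ⟨k, v, h⟩ := hW _ h
        cases h
    obtain ⟨A, B, rfl, hins, hA, hB⟩ :=
      exists_insertRead_eq_of_ordered hm.ordered hreads s.1 s.2
    rw [hins]
    obtain ⟨r, n, v, rfl, -⟩ := hS s (by simp)
    obtain ⟨hordA, hordB, hAB⟩ := List.pairwise_append.1 hm.ordered
    refine ⟨?_, ?_, ?_, ?_⟩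
    · refine List.perm_middle.trans ?_
      rw [List.map_append, List.append_assoc]
      exact (hm.perm.cons _).trans List.perm_middle.symm
    · rw [← hm.writes, List.filterMap_append, List.filterMap_append]
      rfl
    · refine List.pairwise_append.2 ⟨hordA, List.pairwise_cons.2 ⟨?_, hordB⟩, ?_⟩
      · intro b hb
        refine ⟨(hB b hb).le, fun k v' hk => ?_⟩
        have := hB b hb
        rwa [hk] at this
      · intro a ha b hb
        rcases List.mem_cons.1 hb with rfl | hb
        · exact ⟨hA a ha, nofun⟩
        · exact hAB a ha b hb
    · intro a b hab hle
      rcases pair_sublist_concat.1 hab with hab | ⟨ha, rfl⟩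
      · refine (hm.reads a b hab hle).trans ?_
        exact (List.Sublist.refl A).append (List.sublist_cons_self _ _)
      · have haL : a.1 ∈ A ++ B :=
          hm.perm.mem_iff.2 (List.mem_append_left _ (List.mem_map_of_mem ha))
        obtain ⟨r', n', v', rfl, -⟩ := hS a (List.mem_append_left _ ha)
        rcases List.mem_append.1 haL with h | h
        · exact (List.singleton_sublist.2 h).append (List.singleton_sublist.2 (by simp))
        · exact absurd (hB _ h) (not_lt.2 hle)

theorem sublist_of_opTs_lt {τ : R → ℕ → ℕ} {L : List (Op R V × Ret V)}
    (hL : L.Pairwise (TsOrdered τ)) {a b : Op R V × Ret V} (ha : a ∈ L) (hb : b ∈ L)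
    (hab : opTs τ a.1 < opTs τ b.1) : List.Sublist [a, b] L := by
  obtain ⟨A, B, rfl⟩ := List.append_of_mem ha
  rcases List.mem_append.1 hb with hb | hb
  · have := ((List.pairwise_append.1 hL).2.2 b hb a (by simp)).1
    omega
  · rcases List.mem_cons.1 hb with rfl | hb
    · exact absurd hab (lt_irrefl _)
    · exact ((List.singleton_sublist.2 hb).cons_cons a).trans (List.sublist_append_right _ _)

/-- The tie case: a write following the read would need a strictly larger timestamp. -/
theorem sublist_write_of_opTs_le {τ : R → ℕ → ℕ} {L : List (Op R V × Ret V)}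
    (hL : L.Pairwise (TsOrdered τ)) {k : ℕ} {v : V} {x : Ret V} {r : R} {n : ℕ} {y : Ret V}
    (ha : (.write k v, x) ∈ L) (hb : (.read r n, y) ∈ L) (hab : k ≤ τ r n) :
    List.Sublist [(.write k v, x), (.read r n, y)] L := by
  obtain ⟨A, B, rfl⟩ := List.append_of_mem ha
  rcases List.mem_append.1 hb with hb | hb
  · have : τ r n < k := ((List.pairwise_append.1 hL).2.2 _ hb _ List.mem_cons_self).2 _ _ rfl
    omega
  · rcases List.mem_cons.1 hb with hb | hb
    · cases hb
    · exact ((List.singleton_sublist.2 hb).cons_cons _).trans (List.sublist_append_right _ _)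

/-- The sequential history of a list of completed operations. -/
def sequentialHistory (L : List (Op R V × Ret V)) : List (HEvent R V) :=
  L.flatMap fun o => [HEvent.inv o.1, HEvent.res o.1 o.2]

theorem sequential_sequentialHistory (L : List (Op R V × Ret V)) :
    Sequential (sequentialHistory L) := by
  induction L with
  | nil => exact .nil
  | cons a L ih => exact .cons a.1 a.2 _ ih

theorem precedes_sequentialHistory {L : List (Op R V × Ret V)} {a b : Op R V × Ret V}
    (h : List.Sublist [a, b] L) : Precedes (sequentialHistory L) a.1 b.1 := by
  refine ⟨a.2, List.Sublist.trans ?_ (h.flatMap _)⟩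
  exact ((List.Sublist.refl [HEvent.res a.1 a.2]).append
    (List.singleton_sublist.2 (by simp))).trans (List.sublist_cons_self (HEvent.inv a.1)
      [HEvent.res a.1 a.2, HEvent.inv b.1, HEvent.res b.1 b.2])

theorem mem_sequentialHistory {L : List (Op R V × Ret V)} {e : HEvent R V} :
    e ∈ sequentialHistory L ↔ ∃ o x, (o, x) ∈ L ∧ (e = .inv o ∨ e = .res o x) := by
  simp [sequentialHistory]

theorem nodup_sequentialHistory {L : List (Op R V × Ret V)} (h : (L.map Prod.fst).Nodup) :
    (sequentialHistory L).Nodup := by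
  rw [sequentialHistory, List.nodup_flatMap]
  refine ⟨fun a _ => by simp, ?_⟩
  rw [List.Nodup, List.pairwise_map] at h
  exact h.imp fun hab => by simpa [Function.onFun] using ⟨Ne.symm hab, fun h => absurd h.symm hab⟩

/-- For the induction, `k₀` and `cur` are the timestamp and value of the last write already passed;
the initial value counts as a write with timestamp `0`. -/
theorem legal_sequentialHistory {τ : R → ℕ → ℕ} {L : List (Op R V × Ret V)}
    (hL : L.Pairwise (TsOrdered τ)) (k₀ : ℕ) (cur : V)
    (hreads : ∀ r n x, (.read r n, x) ∈ L → ∃ v, x = .value v ∧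
      ((τ r n = k₀ ∧ v = cur) ∨ ∃ y, (.write (τ r n) v, y) ∈ L))
    (hwrites : ∀ k v x, (.write k v, x) ∈ L → k₀ < k) : Legal cur (sequentialHistory L) := by
  induction L generalizing k₀ cur with
  | nil => trivial
  | cons a L ih =>
    obtain ⟨ha, hL'⟩ := List.pairwise_cons.1 hL
    obtain ⟨o, x⟩ := a
    cases o with
    | write k v =>
      refine ih hL' k v ?_ fun k' v' x' h => (ha _ h).2 _ _ rfl
      intro r n y h
      obtain ⟨v', rfl, h'⟩ := hreads r n y (List.mem_cons_of_mem _ h)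
      refine ⟨v', rfl, ?_⟩
      -- After the write of `k > k₀`, sortedness forbids a read with timestamp `k₀`.
      rcases h' with ⟨h', -⟩ | ⟨z, h'⟩
      · have h1 : k ≤ τ r n := (ha _ h).1
        have h2 := hwrites k v x (by simp)
        omega
      · rcases List.mem_cons.1 h' with h' | h'
        · cases h'
          exact Or.inl ⟨rfl, rfl⟩
        · exact Or.inr ⟨z, h'⟩
    | read r n =>
      obtain ⟨v, rfl, h⟩ := hreads r n x (by simp)
      have hv : v = cur := by
        rcases h with ⟨-, h⟩ | ⟨y, h⟩
        · exact h
        · rcases List.mem_cons.1 h with h | h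
          · cases h
          -- The write of the read's own timestamp cannot come later, because writes are strictly
          -- above what precedes them.
          · exact absurd ((ha _ h).2 _ _ rfl) (lt_irrefl _)
      refine ⟨hv, ih hL' k₀ cur ?_ fun k v x h => hwrites k v x (List.mem_cons_of_mem _ h)⟩
      intro r' n' x' h'
      obtain ⟨v', rfl, h''⟩ := hreads r' n' x' (List.mem_cons_of_mem _ h')
      refine ⟨v', rfl, h''.imp id fun ⟨y, h''⟩ => ⟨y, ?_⟩⟩
      simpa using h''

end Insertion

/-! ## The linearization of an execution -/

/-! ### The events of `completeHistory` -/

section Completion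

variable {R V : Type*} {H : List (HEvent R V)}

open Classical in
/-- The responses that `completeHistory` appends. -/
noncomputable def addedResponses (H : List (HEvent R V)) : List (HEvent R V) :=
  ((H.filterMap HEvent.invoked).filter fun o =>
    Pending H o ∧ WritesReturnedValue H o).map fun o => HEvent.res o .ack

theorem completeHistory_eq : completeHistory H = dropPending (H ++ addedResponses H) := rfl

theorem invoked_eq_some {e : HEvent R V} {o : Op R V} : e.invoked = some o ↔ e = .inv o := by
  cases e <;> simp [HEvent.invoked]

theorem mem_addedResponses {e : HEvent R V} :
    e ∈ addedResponses H ↔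
      ∃ o, e = .res o .ack ∧ Pending H o ∧ WritesReturnedValue H o := by
  simp only [addedResponses, List.mem_map, List.mem_filter, decide_eq_true_eq, List.mem_filterMap,
    invoked_eq_some]
  constructor
  · rintro ⟨o, ⟨-, h⟩, rfl⟩
    exact ⟨o, rfl, h⟩
  · rintro ⟨o, rfl, h⟩
    exact ⟨o, ⟨⟨_, h.1.1, rfl⟩, h⟩, rfl⟩

theorem mem_dropPending {e : HEvent R V} : e ∈ dropPending H ↔ e ∈ H ∧ Responded H e.op := by
  simp [dropPending]

theorem responded_append_addedResponses {o : Op R V} :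
    Responded (H ++ addedResponses H) o ↔
      Responded H o ∨ (Pending H o ∧ WritesReturnedValue H o) := by
  constructor
  · rintro ⟨x, h⟩
    rcases List.mem_append.1 h with h | h
    · exact Or.inl ⟨x, h⟩
    · obtain ⟨o', h, h'⟩ := mem_addedResponses.1 h
      cases h
      exact Or.inr h'
  · rintro (⟨x, h⟩ | h)
    · exact ⟨x, List.mem_append_left _ h⟩
    · exact ⟨.ack, List.mem_append_right _ (mem_addedResponses.2 ⟨o, rfl, h⟩)⟩

theorem inv_mem_completeHistory {o : Op R V} :
    .inv o ∈ completeHistory H ↔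
      .inv o ∈ H ∧ (Responded H o ∨ (Pending H o ∧ WritesReturnedValue H o)) := by
  rw [completeHistory_eq, mem_dropPending, HEvent.op, responded_append_addedResponses,
    List.mem_append, or_iff_left]
  intro h
  obtain ⟨_, h, -⟩ := mem_addedResponses.1 h
  cases h

theorem res_mem_completeHistory {o : Op R V} {x : Ret V} :
    .res o x ∈ completeHistory H ↔
      .res o x ∈ H ∨ (x = .ack ∧ Pending H o ∧ WritesReturnedValue H o) := by
  rw [completeHistory_eq, mem_dropPending]
  constructor
  · rintro ⟨h, -⟩
    rcases List.mem_append.1 h with h | h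
    · exact Or.inl h
    · obtain ⟨_, h, h'⟩ := mem_addedResponses.1 h
      cases h
      exact Or.inr ⟨rfl, h'⟩
  · intro h
    have hmem : .res o x ∈ H ++ addedResponses H := by
      rcases h with h | ⟨rfl, h⟩
      · exact List.mem_append_left _ h
      · exact List.mem_append_right _ (mem_addedResponses.2 ⟨o, rfl, h⟩)
    exact ⟨hmem, x, hmem⟩

/-- Added responses stand after every invocation, so completing a history creates no new real-time
constraints. -/
theorem Precedes.of_completeHistory {o₁ o₂ : Op R V} (h : Precedes (completeHistory H) o₁ o₂) :
    .inv o₂ ∈ completeHistory H ∧ Precedes H o₁ o₂ := by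
  obtain ⟨x, h⟩ := h
  refine ⟨h.subset (by simp), x, ?_⟩
  have h' := h.trans (List.filter_sublist (l := H ++ addedResponses H))
  rw [List.sublist_append_iff] at h'
  obtain ⟨l₁, l₂, h, h1, h2⟩ := h'
  rcases List.eq_nil_or_concat l₂ with rfl | ⟨l₂, e, rfl⟩
  · rw [List.append_nil] at h
    rwa [h]
  · have he : e ∈ addedResponses H := h2.subset (by simp)
    obtain ⟨o, rfl, -⟩ := mem_addedResponses.1 he
    -- The pair ends with an invocation, whereas everything appended is a response.
    have hlast := congrArg List.getLast? h
    simp at hlast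

variable (hH : H.Pairwise fun a b => a.op = b.op → ∃ o x, a = .inv o ∧ b = .res o x)
include hH

theorem nodup_of_once : H.Nodup :=
  hH.imp fun h heq => by
    subst heq
    obtain ⟨o, x, h1, h2⟩ := h rfl
    rw [h1] at h2
    cases h2

theorem nodup_invoked_of_once : (H.filterMap HEvent.invoked).Nodup := by
  rw [List.Nodup, List.pairwise_filterMap]
  refine hH.imp fun {a b} h o ho o' ho' heq => ?_
  rw [invoked_eq_some] at ho ho'
  subst ho ho' heq
  obtain ⟨_, _, -, h⟩ := h rfl
  cases h

theorem nodup_completeHistory : (completeHistory H).Nodup := by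
  classical
  refine List.Nodup.filter _ (List.nodup_append'.2 ⟨nodup_of_once hH, ?_, ?_⟩)
  · refine ((nodup_invoked_of_once hH).filter _).map fun o o' h => ?_
    cases h
    rfl
  · intro e he he'
    obtain ⟨o, rfl, hp, -⟩ := mem_addedResponses.1 he'
    exact hp.2 ⟨_, he⟩

theorem isCompletion_completeHistory : IsCompletion H (completeHistory H) := by
  classical
  refine ⟨addedResponses H, ?_, ?_, rfl⟩
  · intro e he
    obtain ⟨o, rfl, hp, hw⟩ := mem_addedResponses.1 he
    refine ⟨o, .ack, rfl, hp, ?_⟩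
    cases o with
    | write k v => trivial
    | read r n => exact hw
  · rw [addedResponses, List.map_map]
    exact ((nodup_invoked_of_once hH).filter _).map fun o o' h => h

end Completion

/-! ### From trace properties to a linearization -/

section Linearization

variable {f : ℕ} {R V : Type*} {v₀ : V} {E : List (Label f R V)}

theorem mem_returnedRead {s : (Op R V × Ret V) × ℕ} :
    s ∈ E.filterMap Label.returnedRead ↔
      ∃ r n v t, s = ((.read r n, .value v), t) ∧ .readRes r n v t ∈ E := by
  rw [List.mem_filterMap]
  constructor
  · rintro ⟨l, hl, h⟩
    cases l <;> try cases h
    exact ⟨_, _, _, _, rfl, hl⟩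
  · rintro ⟨r, n, v, t, rfl, h⟩
    exact ⟨_, h, rfl⟩

/-- The writes of `complete(H)`, as completed operations. -/
noncomputable def completedWrites (E : List (Label f R V)) : List (Op R V × Ret V) :=
  (completeHistory (history E)).filterMap HEvent.startedWrite

theorem mem_completedWrites {w : Op R V × Ret V} :
    w ∈ completedWrites E ↔
      ∃ k v, w = (.write k v, .ack) ∧ .inv (.write k v) ∈ completeHistory (history E) := by
  rw [completedWrites, List.mem_filterMap]
  constructor
  · rintro ⟨e, he, h⟩
    rcases e with (⟨k, v⟩ | _) | _ <;> cases h
    exact ⟨k, v, rfl, he⟩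
  · rintro ⟨k, v, rfl, h⟩
    exact ⟨_, h, rfl⟩

theorem exists_labels_of_precedes {o₁ o₂ : Op R V} (hp : Precedes (history E) o₁ o₂) :
    ∃ x l₁ l₂, l₁.event = some (.res o₁ x) ∧ l₂.event = some (.inv o₂) ∧
      List.Sublist [l₁, l₂] E := by
  obtain ⟨x, hp⟩ := hp
  obtain ⟨l', hl', heq⟩ := List.sublist_filterMap_iff.1 hp
  obtain ⟨A, l₁, B, rfl, -, h1, h2⟩ := List.filterMap_eq_cons_iff.1 heq.symm
  obtain ⟨l₂, hl₂, h3⟩ : ∃ l₂ ∈ B, l₂.event = some (.inv o₂) := List.mem_filterMap.1 (by simp [h2])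
  exact ⟨x, l₁, l₂, h1, h3, (((List.singleton_sublist.2 hl₂).cons_cons l₁).trans
    (List.sublist_append_right _ _)).trans hl'⟩

namespace TraceInv

variable (h : TraceInv v₀ E)
include h

theorem nodup_returnedReads : ((E.filterMap Label.returnedRead).map fun s => s.1.1).Nodup := by
  have h1 := h.once
  rw [history, List.pairwise_filterMap] at h1
  rw [List.Nodup, List.pairwise_map, List.pairwise_filterMap]
  refine h1.imp fun {a b} hab s hs s' hs' heq => ?_
  cases a <;> try cases hs
  cases b <;> try cases hs'
  obtain ⟨_, _, h2, -⟩ := hab _ rfl _ rfl heq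
  cases h2

theorem readRes_unique {r : R} {n : ℕ} {v v' : V} {t t' : ℕ} (h1 : .readRes r n v t ∈ E)
    (h2 : .readRes r n v' t' ∈ E) : v = v' ∧ t = t' := by
  have := List.inj_on_of_nodup_map h.nodup_returnedReads
    (mem_returnedRead.2 ⟨r, n, v, t, rfl, h1⟩) (mem_returnedRead.2 ⟨r, n, v', t', rfl, h2⟩) rfl
  cases this
  exact ⟨rfl, rfl⟩

/-- A response is unique to its read, so timestamps of complete reads form a function; the default
`0` concerns only reads that never return. -/
theorem exists_readTs : ∃ τ : R → ℕ → ℕ, ∀ r n v t, .readRes r n v t ∈ E → τ r n = t := by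
  classical
  refine ⟨fun r n => if hr : ∃ t v, .readRes r n v t ∈ E then hr.choose else 0, ?_⟩
  intro r n v t hv
  have hr : ∃ t v, .readRes r n v t ∈ E := ⟨t, v, hv⟩
  dsimp only
  rw [dif_pos hr]
  exact (h.readRes_unique hr.choose_spec.choose_spec hv).2

/-- This is the purpose of the completion rule: if the write that was read is still pending, its
value has been returned and so the rule keeps it. -/
theorem completed_of_read {r : R} {n : ℕ} {v : V} {t : ℕ} (hr : .readRes r n v t ∈ E) :
    (t = 0 ∧ v = v₀) ∨ (.write t v, .ack) ∈ completedWrites E := by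
  refine (h.authored r n v t hr).imp id fun hw => ?_
  have hw' := inv_write_mem_history.2 hw
  refine mem_completedWrites.2 ⟨t, v, rfl, inv_mem_completeHistory.2 ⟨hw', ?_⟩⟩
  by_cases hp : Responded (history E) (.write t v)
  · exact Or.inl hp
  · exact Or.inr ⟨⟨hw', hp⟩, r, n, res_read_mem_history.2 ⟨v, t, rfl, hr⟩⟩

theorem completedWrites_lt :
    ((completedWrites E).filterMap writeTimestamp).Pairwise (· < ·) := by
  have h1 : ((history E).filterMap HEvent.startedWrite).filterMap writeTimestamp |>.Pairwise
      (· < ·) := by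
    rw [history, List.pairwise_filterMap, List.pairwise_filterMap, List.pairwise_filterMap]
    refine h.writes.imp fun {a b} hab e he e' he' w hw w' hw' k hk k' hk' => ?_
    rcases e with (⟨i, v⟩ | _) | _ <;> cases hw
    rcases e' with (⟨j, v'⟩ | _) | _ <;> cases hw'
    cases hk
    cases hk'
    cases a <;> cases he
    cases b <;> cases he'
    exact hab _ _ _ (Or.inr ⟨_, rfl⟩) rfl
  refine h1.sublist (List.Sublist.filterMap _ ?_)
  have h2 : (addedResponses (history E)).filterMap HEvent.startedWrite = [] := by
    rw [List.filterMap_eq_nil_iff]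
    intro e he
    obtain ⟨o, rfl, -⟩ := mem_addedResponses.1 he
    rfl
  have h3 : (history E).filterMap HEvent.startedWrite =
      (history E ++ addedResponses (history E)).filterMap HEvent.startedWrite := by
    rw [List.filterMap_append, h2, List.append_nil]
  rw [h3]
  exact List.Sublist.filterMap _ List.filter_sublist

theorem isMerge {τ : R → ℕ → ℕ} (hτ : ∀ r n v t, .readRes r n v t ∈ E → τ r n = t) :
    IsMerge τ (completedWrites E) (E.filterMap Label.returnedRead) (linearizedOps E) := by
  refine isMerge_foldl_insertRead (fun w hw => ?_) h.completedWrites_lt fun s hs => ?_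
  · obtain ⟨k, v, hw, -⟩ := mem_completedWrites.1 hw
    exact ⟨k, v, hw⟩
  · obtain ⟨r, n, v, t, rfl, hr⟩ := mem_returnedRead.1 hs
    obtain rfl := hτ r n v t hr
    exact ⟨r, n, v, rfl, (h.completed_of_read hr).imp And.left fun hw => ⟨v, hw⟩⟩

theorem mem_linearizedOps {a : Op R V × Ret V} :
    a ∈ linearizedOps E ↔ (∃ r n v t, a = (.read r n, .value v) ∧ .readRes r n v t ∈ E) ∨
      a ∈ completedWrites E := by
  obtain ⟨τ, hτ⟩ := h.exists_readTs
  rw [(h.isMerge hτ).perm.mem_iff, List.mem_append, List.mem_map]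
  refine or_congr_left ⟨?_, ?_⟩
  · rintro ⟨s, hs, rfl⟩
    obtain ⟨r, n, v, t, rfl, hr⟩ := mem_returnedRead.1 hs
    exact ⟨r, n, v, t, rfl, hr⟩
  · rintro ⟨r, n, v, t, rfl, hr⟩
    exact ⟨_, mem_returnedRead.2 ⟨r, n, v, t, rfl, hr⟩, rfl⟩

theorem nodup_linearizedOps : ((linearizedOps E).map Prod.fst).Nodup := by
  obtain ⟨τ, hτ⟩ := h.exists_readTs
  rw [((h.isMerge hτ).perm.map Prod.fst).nodup_iff, List.map_append, List.map_map,
    List.nodup_append']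
  refine ⟨h.nodup_returnedReads, ?_, ?_⟩
  · have h1 := h.completedWrites_lt
    rw [List.pairwise_filterMap] at h1
    rw [List.Nodup, List.pairwise_map]
    refine h1.imp_of_mem fun {a b} ha hb hab heq => ?_
    obtain ⟨k, v, rfl, -⟩ := mem_completedWrites.1 ha
    obtain ⟨k', v', rfl, -⟩ := mem_completedWrites.1 hb
    cases heq
    exact lt_irrefl _ (hab k rfl k rfl)
  · intro o ho ho'
    obtain ⟨s, hs, rfl⟩ := List.mem_map.1 ho
    obtain ⟨r, n, v, t, rfl, -⟩ := mem_returnedRead.1 hs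
    obtain ⟨w, hw, heq⟩ := List.mem_map.1 ho'
    obtain ⟨k, v', rfl, -⟩ := mem_completedWrites.1 hw
    cases heq

theorem mem_linearization_iff {e : HEvent R V} :
    e ∈ linearization E ↔ e ∈ completeHistory (history E) := by
  have hread : ∀ {r n}, .inv (.read r n) ∈ completeHistory (history E) ↔
      ∃ v t, .readRes r n v t ∈ E := by
    intro r n
    rw [inv_mem_completeHistory]
    constructor
    · rintro ⟨-, ⟨x, hx⟩ | ⟨-, hw⟩⟩
      · obtain ⟨v, t, -, hr⟩ := res_read_mem_history.1 hx
        exact ⟨v, t, hr⟩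
      · exact hw.elim
    · rintro ⟨v, t, hr⟩
      exact ⟨inv_read_mem_history.2 (h.readRes r n v t hr),
        Or.inl ⟨_, res_read_mem_history.2 ⟨v, t, rfl, hr⟩⟩⟩
  change e ∈ sequentialHistory (linearizedOps E) ↔ _
  simp only [mem_sequentialHistory, h.mem_linearizedOps]
  constructor
  · rintro ⟨o, x, ⟨r, n, v, t, ho, hr⟩ | hw, he⟩
    · cases ho
      rcases he with rfl | rfl
      · exact hread.2 ⟨v, t, hr⟩
      · exact res_mem_completeHistory.2 (Or.inl (res_read_mem_history.2 ⟨v, t, rfl, hr⟩))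
    · obtain ⟨k, v, ho, hinv⟩ := mem_completedWrites.1 hw
      cases ho
      rcases he with rfl | rfl
      · exact hinv
      · rw [res_mem_completeHistory]
        refine (inv_mem_completeHistory.1 hinv).2.imp (fun ⟨x, hx⟩ => ?_) fun hp => ⟨rfl, hp⟩
        rwa [(res_write_mem_history.1 hx).1] at hx
  · intro he
    rcases e with (⟨k, v⟩ | ⟨r, n⟩) | ⟨⟨k, v⟩ | ⟨r, n⟩, x⟩
    · exact ⟨_, _, Or.inr (mem_completedWrites.2 ⟨k, v, rfl, he⟩), Or.inl rfl⟩
    · obtain ⟨v, t, hr⟩ := hread.1 he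
      exact ⟨_, _, Or.inl ⟨r, n, v, t, rfl, hr⟩, Or.inl rfl⟩
    · refine ⟨_, _, Or.inr (mem_completedWrites.2 ⟨k, v, rfl, ?_⟩), Or.inr ?_⟩
      · rw [inv_mem_completeHistory]
        rcases res_mem_completeHistory.1 he with hx | ⟨-, hp⟩
        · exact ⟨inv_write_mem_history.2 (h.writeRes k v (res_write_mem_history.1 hx).2),
            Or.inl ⟨x, hx⟩⟩
        · exact ⟨hp.1.1, Or.inr hp⟩
      · rcases res_mem_completeHistory.1 he with hx | ⟨rfl, -⟩
        · rw [(res_write_mem_history.1 hx).1]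
        · rfl
    · rcases res_mem_completeHistory.1 he with hx | ⟨-, -, hw⟩
      · obtain ⟨v, t, rfl, hr⟩ := res_read_mem_history.1 hx
        exact ⟨_, _, Or.inl ⟨r, n, v, t, rfl, hr⟩, Or.inr rfl⟩
      · exact hw.elim

theorem linearization_perm : (linearization E).Perm (completeHistory (history E)) :=
  (List.perm_ext_iff_of_nodup (nodup_sequentialHistory h.nodup_linearizedOps)
    (nodup_completeHistory h.once)).2 fun _ => h.mem_linearization_iff

theorem legal_linearization : Legal v₀ (linearization E) := by
  obtain ⟨τ, hτ⟩ := h.exists_readTs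
  refine legal_sequentialHistory (h.isMerge hτ).ordered 0 v₀ ?_ ?_
  · intro r n x hx
    rcases h.mem_linearizedOps.1 hx with ⟨r, n, v, t, heq, hr⟩ | hw
    · cases heq
      obtain rfl := hτ r n v t hr
      exact ⟨v, rfl, (h.completed_of_read hr).imp id fun hw =>
        ⟨_, h.mem_linearizedOps.2 (Or.inr hw)⟩⟩
    · obtain ⟨_, _, heq, -⟩ := mem_completedWrites.1 hw
      cases heq
  · intro k v x hx
    rcases h.mem_linearizedOps.1 hx with ⟨_, _, _, _, heq, -⟩ | hw
    · cases heq
    · obtain ⟨k, v, heq, hinv⟩ := mem_completedWrites.1 hw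
      cases heq
      exact h.one_le k v (inv_write_mem_history.1 (inv_mem_completeHistory.1 hinv).1)

/-- If `o₂` is a write, its timestamp is strictly larger and sortedness suffices. If `o₂` is a read,
its timestamp is at least that of `o₁`; ties are settled by write-before-read when `o₁` is a write
and by response order when it is a read. -/
theorem precedes_linearization {o₁ o₂ : Op R V}
    (ho₂ : .inv o₂ ∈ completeHistory (history E)) (hp : Precedes (history E) o₁ o₂) :
    Precedes (linearization E) o₁ o₂ := by
  obtain ⟨τ, hτ⟩ := h.exists_readTs
  have hm := h.isMerge hτ
  obtain ⟨x, l₁, l₂, h1, h2, hsub⟩ := exists_labels_of_precedes hp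
  have hl₁ : l₁ ∈ E := hsub.subset (by simp)
  obtain ⟨b, hb, hbo⟩ : ∃ b ∈ linearizedOps E, b.1 = o₂ := by
    obtain ⟨o, y, hb, heq⟩ := mem_sequentialHistory.1 (h.mem_linearization_iff.2 ho₂)
    rcases heq with heq | heq
    · cases heq
      exact ⟨_, hb, rfl⟩
    · cases heq
  obtain ⟨a, ha, k, hao, hk, hkts⟩ : ∃ a ∈ linearizedOps E, ∃ k, a.1 = o₁ ∧
      l₁.completedTs = some k ∧ opTs τ o₁ = k := by
    cases l₁ <;> try cases h1
    · rename_i k v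
      refine ⟨_, h.mem_linearizedOps.2 (Or.inr (mem_completedWrites.2 ⟨k, v, rfl, ?_⟩)), k, rfl,
        rfl, rfl⟩
      exact inv_mem_completeHistory.2 ⟨inv_write_mem_history.2 (h.writeRes k v hl₁),
        Or.inl ⟨_, res_write_mem_history.2 ⟨rfl, hl₁⟩⟩⟩
    · rename_i r n v t
      exact ⟨_, h.mem_linearizedOps.2 (Or.inl ⟨r, n, v, t, rfl, hl₁⟩), t, rfl, rfl,
        hτ r n v t hl₁⟩
  suffices hs : List.Sublist [a, b] (linearizedOps E) by
    have := precedes_sequentialHistory hs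
    rwa [hao, hbo] at this
  subst hao hbo hkts
  rcases h.mem_linearizedOps.1 hb with ⟨r, n, v, t, rfl, hr⟩ | hw
  · have hl₂ : l₂ = .readInv r n := by
      cases l₂ <;> cases h2
      rfl
    subst hl₂
    obtain ⟨hle, hord⟩ := h.reads _ _ r n v t hk hsub hr
    rcases h.mem_linearizedOps.1 ha with ⟨r', n', v', t', rfl, hr'⟩ | hw
    · refine hm.reads ((.read r' n', .value v'), t') ((.read r n, .value v), t) ?_ ?_
      · have hl₁' : l₁ = .readRes r' n' v' t' := by
          cases l₁ <;> cases h1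
          obtain ⟨rfl, rfl⟩ := h.readRes_unique hl₁ hr'
          rfl
        subst hl₁'
        -- The order of the two responses in `E` is the order in which the reads are inserted.
        exact hord.filterMap Label.returnedRead
      · rwa [← hτ r' n' v' t' hr']
    · obtain ⟨k, v', rfl, -⟩ := mem_completedWrites.1 hw
      refine sublist_write_of_opTs_le hm.ordered ha hb ?_
      rw [hτ r n v t hr]
      exact hle
  · obtain ⟨k, v, rfl, -⟩ := mem_completedWrites.1 hw
    have hl₂ : l₂ = .writeInv k v := by
      cases l₂ <;> cases h2
      rfl
    subst hl₂
    refine sublist_of_opTs_lt hm.ordered ha hb ?_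
    exact List.pairwise_iff_forall_sublist.1 h.writes hsub _ _ _ (Or.inl hk) rfl

theorem isLinearization :
    IsLinearization v₀ (completeHistory (history E)) (linearization E) where
  sequential := sequential_sequentialHistory _
  sameOps := h.linearization_perm
  legal := h.legal_linearization
  realTime _ _ hp := h.precedes_linearization hp.of_completeHistory.1 hp.of_completeHistory.2

end TraceInv

end Linearization

end AuditableRegister

theorem mainTheorem1 {R V : Type*} [DecidableEq R] (f : ℕ) (v₀ : V)
    (byzS : Finset (AuditableRegister.Server f)) (hbyz : byzS.card ≤ f) (byzR : Set R)
    (E : List (AuditableRegister.Label f R V))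
    (hE : AuditableRegister.IsExecution v₀ byzS byzR E) :
    -- real-time order: for operations of `complete(H)`, if `o₁` ends before `o₂` is invoked,
    -- then `o₁` precedes `o₂` in `π`
    (∀ o₁ o₂ : AuditableRegister.Op R V,
      AuditableRegister.HEvent.inv o₂ ∈
        AuditableRegister.completeHistory (AuditableRegister.history E) →
      AuditableRegister.Precedes (AuditableRegister.history E) o₁ o₂ →
      AuditableRegister.Precedes (AuditableRegister.linearization E) o₁ o₂) ∧
    -- the writes are ordered by timestamp in `π`
    ((AuditableRegister.linearizedOps E).filterMap
      AuditableRegister.writeTimestamp).Pairwise (· < ·) ∧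
    -- `π` witnesses the atomicity of the history
    AuditableRegister.IsCompletion (AuditableRegister.history E)
      (AuditableRegister.completeHistory (AuditableRegister.history E)) ∧
    AuditableRegister.IsLinearization v₀
      (AuditableRegister.completeHistory (AuditableRegister.history E))
      (AuditableRegister.linearization E) ∧
    AuditableRegister.Atomic v₀ (AuditableRegister.history E) := by
  obtain ⟨c, hc⟩ := hE
  have h := (hc.systemInv hbyz).trace
  obtain ⟨τ, hτ⟩ := h.exists_readTs
  have hcomp := AuditableRegister.isCompletion_completeHistory h.once
  refine ⟨fun o₁ o₂ => h.precedes_linearization, ?_, hcomp, h.isLinearization, _, _, hcomp,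
    h.isLinearization⟩
  rw [(h.isMerge hτ).writes]
  exact h.completedWrites_lt
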